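/- Let $n\ge 3$, let $G=U(n)$ and let $G'=U(n-1)\subset G$ be the subgroup fixing the last basis vector $e_n$. Let $U(1)U(n-1)\subset G$ be the block-diagonal subgroup (the stabilizer of the line $\mathbb{C}e_1$), let $X=U(n)/U(1)U(n-1)=\mathbb{CP}^{n-1}$, and let $Y=U(n-1)/U(1)U(n-2)=\mathbb{CP}^{n-2}\subset X$, where $U(1)U(n-2)=G'\cap U(1)U(n-1)$. An irreducible unitary representation $\Pi$ of $G$ (respectively $\pi$ of $G'$) is said to be in the discrete spectrum of $X$ (respectively of $Y$) if there is a nonzero bounded $G$-equivariant operator $\Pi\to L^2(X)$ (respectively a nonzero bounded $G'$-equivariant operator $\pi\to L^2(Y)$); here $L^2$ is taken with respect to the invariant probability measure, and the group acts by left translation. Let $a,b$ be integers. Let $\Pi$ be an irreducible unitary representation of $U(n)$ in the discrete spectrum of $X$ with highest weight $(a,0,\dots,0,-a)\in\mathbb{Z}^{n}$, and let $\pi$ be an irreducible unitary representation of $U(n-1)$ in the discrete spectrum of $Y$ with highest weight $(b,0,\dots,0,-b)\in\mathbb{Z}^{n-1}$. Let $\operatorname{Hom}_{G'}(\Pi|_{G'},\pi)$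 be the complex vector space of bounded $G'$-equivariant linear operators from $\Pi$ to $\pi$. Then $$\operatorname{Hom}_{G'}(\Pi|_{G'},\pi)\neq 0\quad\Longleftrightarrow\quad a\ge b\ge 0,$$ and in that case $\dim_{\mathbb{C}}\operatorname{Hom}_{G'}(\Pi|_{G'},\pi)=1$. -/

import Mathlib

open scoped ContRepresentation

noncomputable section

namespace CPBranching

open MeasureTheory

/-- The compact unitary group `U(n)`. -/
abbrev U (n : ℕ) : Type := Matrix.unitaryGroup (Fin n) ℂ

instance (n : ℕ) : MeasurableSpace (U n) := borel _

instance (n : ℕ) : BorelSpace (U n) := ⟨rfl⟩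

instance (n : ℕ) : CompactSpace (U n) := by
  apply isCompact_iff_compactSpace.1
  have hK : IsCompact (Set.univ.pi fun _ : Fin n =>
      Set.univ.pi fun _ : Fin n => Metric.closedBall (0 : ℂ) 1) :=
    isCompact_univ_pi fun _ => isCompact_univ_pi fun _ => isCompact_closedBall _ _
  have hc : IsClosed {A : Matrix (Fin n) (Fin n) ℂ | A * star A = 1} :=
    isClosed_eq (by fun_prop) (by fun_prop)
  have he : (Matrix.unitaryGroup (Fin n) ℂ : Set (Matrix (Fin n) (Fin n) ℂ))
      = {A : Matrix (Fin n) (Fin n) ℂ | A * star A = 1} := by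
    ext A
    exact Matrix.mem_unitaryGroup_iff
  refine IsCompact.of_isClosed_subset hK (by rw [he]; exact hc) fun A hA => ?_
  intro i _ j _
  simpa using entry_norm_bound_of_unitary hA i j

/-- The subgroup `U(1)U(n-1)` of `U(n)` of block-diagonal matrices with blocks of size `1` and
`n - 1`, that is the stabilizer of the line spanned by the first basis vector. -/
def blockSubgroup (n : ℕ) : Subgroup (U n) where
  carrier := {g | ∀ i j : Fin n, (i : ℕ) = 0 → (j : ℕ) ≠ 0 → g.1 i j = 0 ∧ g.1 j i = 0}
  one_mem' := by
    intro i j hi hj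
    have hij : i ≠ j := by rintro rfl; exact hj hi
    simp [hij, hij.symm]
  mul_mem' := by
    intro g h hg hh i j hi hj
    simp only [Submonoid.coe_mul, Matrix.mul_apply]
    constructor <;> refine Finset.sum_eq_zero fun k _ => ?_ <;> by_cases hk : (k : ℕ) = 0
    · simp [(hh k j hk hj).1]
    · simp [(hg i k hi hk).1]
    · simp [(hg k j hk hj).2]
    · simp [(hh i k hi hk).2]
  inv_mem' := by
    intro g hg i j hi hj
    have h := hg i j hi hj
    change star (g.1 j i) = 0 ∧ star (g.1 i j) = 0
    simp [h.1, h.2]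

/-- The compact symmetric space `U(n)/U(1)U(n-1)`, i.e. complex projective space
`ℂP^(n-1)`, with its left action of `U(n)`. -/
abbrev CP (n : ℕ) : Type := U n ⧸ blockSubgroup n

/-- The `U(n)`-invariant probability measure on `U(n)/U(1)U(n-1)`: the image of the normalized
Haar measure of `U(n)`. -/
def invMeasure (n : ℕ) : Measure (CP n) :=
  (Measure.haarMeasure (⊤ : TopologicalSpace.PositiveCompacts (U n))).map
    (QuotientGroup.mk : U n → CP n)

instance (n : ℕ) : IsProbabilityMeasure (invMeasure n) := by
  have : IsProbabilityMeasure
      (Measure.haarMeasure (⊤ : TopologicalSpace.PositiveCompacts (U n))) :=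
    ⟨Measure.haarMeasure_self (K₀ := (⊤ : TopologicalSpace.PositiveCompacts (U n)))⟩
  exact Measure.isProbabilityMeasure_map QuotientGroup.measurable_coe.aemeasurable

theorem invMeasure_measurePreserving (n : ℕ) (g : U n) :
    MeasurePreserving (fun x : CP n => g • x) (invMeasure n) (invMeasure n) := by
  have hm : Measurable (fun x : CP n => g • x) :=
    QuotientGroup.measurable_from_quotient.2
      (QuotientGroup.measurable_coe.comp (measurable_const_mul g))
  refine ⟨hm, ?_⟩
  rw [invMeasure, Measure.map_map hm QuotientGroup.measurable_coe]
  conv_rhs => rw [← map_mul_left_eq_self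
    (Measure.haarMeasure (⊤ : TopologicalSpace.PositiveCompacts (U n))) g]
  rw [Measure.map_map QuotientGroup.measurable_coe (measurable_const_mul g)]
  rfl

/-- The Hilbert space `L²(U(n)/U(1)U(n-1))`. -/
abbrev L2CP (n : ℕ) : Type := Lp ℂ 2 (invMeasure n)

section Rep

variable {G V : Type*} [Group G] [TopologicalSpace G]
  [NormedAddCommGroup V] [InnerProductSpace ℂ V]

/-- A unitary representation: every group element acts isometrically (hence, the action being
invertible, unitarily), and all orbit maps are continuous. -/
structure IsUnitaryRep (π : ContRepresentation ℂ G V) : Prop where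
  norm_map : ∀ g v, ‖π g v‖ = ‖v‖
  continuous_orbit : ∀ v, Continuous fun g => π g v

/-- Topological irreducibility: the space is nonzero and has no closed invariant subspaces besides
`0` and itself. -/
structure IsIrreducibleRep (π : ContRepresentation ℂ G V) : Prop where
  nontrivial : Nontrivial V
  eq_bot_or_top : ∀ W : Submodule ℂ V, IsClosed (W : Set V) →
    (∀ g, ∀ v ∈ W, π g v ∈ W) → W = ⊥ ∨ W = ⊤

end Rep

section Unitary

variable {n : ℕ} {V : Type*} [NormedAddCommGroup V] [InnerProductSpace ℂ V]

/-- `Hom_{U(n)}(π, L²(U(n)/U(1)U(n-1))) ≠ 0`: there is a nonzero bounded operator intertwining `π`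
with the left regular representation `(g • f)(x) = f(g⁻¹ x)`. -/
def OccursInL2CP (π : ContRepresentation ℂ (U n) V) : Prop :=
  ∃ T : V →L[ℂ] L2CP n, T ≠ 0 ∧
    ∀ (g : U n) (v : V), T (π g v) =ᵐ[invMeasure n] fun x => T v (g⁻¹ • x)

/-- `π` is an irreducible unitary representation of `U(n)` in the discrete spectrum of
`U(n)/U(1)U(n-1)`. -/
structure IsInDiscreteSpectrum (π : ContRepresentation ℂ (U n) V) : Prop where
  unitary : IsUnitaryRep π
  irreducible : IsIrreducibleRep π
  occurs : OccursInL2CP π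

/-- The diagonal unitary matrix with diagonal entries `t 0, …, t (n-1)`; these matrices form the
standard maximal torus. -/
def torusElt (t : Fin n → Circle) : U n :=
  ⟨Matrix.diagonal fun i => (t i : ℂ), by
    rw [Matrix.mem_unitaryGroup_iff, Matrix.star_eq_conjTranspose, Matrix.diagonal_conjTranspose,
      Matrix.diagonal_mul_diagonal, ← Matrix.diagonal_one]
    congr 1
    ext i
    simp [Complex.mul_conj]⟩

/-- `μ ∈ ℤⁿ` is a weight of `π`: some nonzero vector transforms under the diagonal torus by the
character `t ↦ ∏ tᵢ ^ μᵢ`. -/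
def IsWeight (π : ContRepresentation ℂ (U n) V) (μ : Fin n → ℤ) : Prop :=
  ∃ v : V, v ≠ 0 ∧ ∀ t : Fin n → Circle, π (torusElt t) v = (∏ i, (t i : ℂ) ^ μ i) • v

/-- The cone of nonnegative integral combinations of the positive roots `eᵢ - eⱼ`, `i < j`. -/
def positiveRootCone (n : ℕ) : AddSubmonoid (Fin n → ℤ) :=
  AddSubmonoid.closure {α | ∃ i j : Fin n, i < j ∧ α = Pi.single i 1 - Pi.single j 1}

/-- `wt` is the highest weight of `π`: it is a weight, and it dominates every weight in the usual
order (the difference is a sum of positive roots). -/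
def IsHighestWeight (π : ContRepresentation ℂ (U n) V) (wt : Fin n → ℤ) : Prop :=
  IsWeight π wt ∧ ∀ μ, IsWeight π μ → wt - μ ∈ positiveRootCone n

/-- The tuple `(a, 0, …, 0, -a)` of length `n` (used for `n ≥ 2`). -/
def sphericalWeight (n : ℕ) (a : ℤ) : Fin n → ℤ := fun i =>
  if (i : ℕ) = 0 then a else if (i : ℕ) + 1 = n then -a else 0

end Unitary

/-- The embedding `U(m) → U(m+1)`, `A ↦ diag(A, 1)`, onto the subgroup fixing the last basis
vector. -/
def embed (m : ℕ) : U m →* U (m + 1) where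
  toFun A := ⟨Matrix.reindex finSumFinEquiv finSumFinEquiv
      (Matrix.fromBlocks A.1 0 0 (1 : Matrix (Fin 1) (Fin 1) ℂ)), by
    have hA : A.1 * A.1.conjTranspose = 1 := Matrix.mem_unitaryGroup_iff.1 A.2
    rw [Matrix.mem_unitaryGroup_iff, Matrix.star_eq_conjTranspose, Matrix.conjTranspose_reindex,
      Matrix.reindex_apply, Matrix.reindex_apply, Matrix.submatrix_mul_equiv,
      Matrix.fromBlocks_conjTranspose, Matrix.fromBlocks_multiply]
    simp [hA]⟩
  map_one' := by
    refine Subtype.ext ?_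
    simp [Matrix.fromBlocks_one]
  map_mul' A B := by
    refine Subtype.ext ?_
    simp [Matrix.submatrix_mul_equiv, Matrix.fromBlocks_multiply]

end CPBranching

end

/-!
Write `X = ℂP^(n-1)` and let `zᵢ z̄ⱼ` (`|z| = 1`) be the entries of the projection onto the line
`[z] ∈ X`. Their products of length `k` span the space `linForms n ^ k` of functions of degree
`k`, which is finite-dimensional and `U(n)`-invariant, and `harmonic n k` is its part orthogonal to
all smaller degrees.

*Irreducibility* (`eq_bot_or_eq_harmonic`). A nonzero invariant subspace of `harmonic n k` contains
a nonzero function fixed by `U(1)U(n-1)`. As every orbit of this group meets a fixed meridian, a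
fixed function of degree `k` is a polynomial of degree at most `k` in `|z₁|²`; modulo smaller degree
these form a line, so that there cannot be two complementary invariant subspaces.

*Discrete spectrum* (`IsInDiscreteSpectrum.exists_isModel`, `IsModel.eq_of_isHighestWeight`). The
functions of all degrees are dense in `L²(X)`, so the adjoint of a nonzero intertwiner `Π → L²(X)`
restricts to an isomorphism of some `harmonic n k` onto `Π`. The function `(zᵢ z̄ⱼ)ᵏ`, `i ≠ j`, is
harmonic for weight reasons, and yields the highest weight `(k, 0, …, 0, -k)`. In particular
highest weights `(a, 0, …, 0, -a)` have `a ≥ 0`.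

*Upper bound* (`intertwiner_eq_zero`, `exists_harmonic_ne_zero`, `finrank_intertwiners_eq_one`). Let
`T : Π → π` be an intertwiner for `U(n-1)`, composed with the projection of the functions of degree
`a` onto `Π`. The centre of `U(n-1)` acts trivially on `π`, and modulo smaller degree
`|zₙ|² = -|z₁|² - … - |zₙ₋₁|²`; hence `T` is determined by its values on the homogeneous polynomials
of bidegree `(a, a)` in the first `n - 1` coordinates. Restriction identifies these with the
functions of degree `a` on the hyperplane `Y`, that is with the sum of the `harmonic (n-1) j` for
`j ≤ a`. By Schur's lemma only `j = b` contributes, and it contributes at most a scalar.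

*Existence* (`exists_intertwiner_ne_zero`). If `b ≤ a`, multiplication by `|zₙ|^(2(a-b))` followed
by the projection onto `Π` maps `harmonic (n-1) b` to `Π` equivariantly, and its adjoint goes from
`Π` to `π`. It does not kill `(z₁ z̄ₙ₋₁)ᵇ`: for a suitable unitary `g` the translate by `g` of
`(z₁ z̄ₙ₋₁)ᵇ |zₙ|^(2(a-b))` contains `(z₁ z̄ₙ₋₁)ᵃ` with nonzero coefficient
(`IsModel.apply_ne_zero`).
-/

noncomputable section

namespace CPBranching

open MeasureTheory
open scoped ComplexConjugate ENNReal

/-! ### Projective space and its coordinate functions -/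

theorem sum_conj_mul_col {n : ℕ} (g : U n) (i j : Fin n) :
    ∑ k, conj (g.1 k i) * g.1 k j = if i = j then 1 else 0 := by
  have h := congrFun (congrFun (Matrix.mem_unitaryGroup_iff'.1 g.2) i) j
  simpa [Matrix.mul_apply, Matrix.star_apply, Matrix.one_apply] using h

theorem coe_inv_apply {n : ℕ} (g : U n) (i j : Fin n) : (g⁻¹).1 i j = conj (g.1 j i) := rfl

theorem mem_blockSubgroup_iff {n : ℕ} [NeZero n] {g : U n} :
    g ∈ blockSubgroup n ↔ ∀ j : Fin n, j ≠ 0 → g.1 0 j = 0 ∧ g.1 j 0 = 0 := by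
  constructor
  · intro h j hj
    exact h 0 j (by simp) fun hj' => hj (Fin.ext (by simpa using hj'))
  · intro h i j hi hj
    have hi' : i = 0 := Fin.ext (by simpa using hi)
    subst hi'
    exact h j (by rintro rfl; simp at hj)

theorem norm_corner_of_mem {n : ℕ} [NeZero n] {k : U n} (hk : k ∈ blockSubgroup n) :
    k.1 0 0 * conj (k.1 0 0) = 1 := by
  have h := sum_conj_mul_col k 0 0
  rw [Finset.sum_eq_single 0] at h
  · simpa [mul_comm] using h
  · intro b _ hb
    simp [(mem_blockSubgroup_iff.1 hk b hb).2]
  · simp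

theorem mul_apply_zero_of_mem {n : ℕ} [NeZero n] (g : U n) {k : U n}
    (hk : k ∈ blockSubgroup n) (i : Fin n) : (g * k).1 i 0 = g.1 i 0 * k.1 0 0 := by
  change (g.1 * k.1) i 0 = _
  rw [Matrix.mul_apply, Finset.sum_eq_single 0]
  · intro b _ hb
    simp [(mem_blockSubgroup_iff.1 hk b hb).2]
  · simp

/-- The function `[z] ↦ zᵢ z̄ⱼ / |z|²` on projective space, where `z = g e₁`; these are the entries
of the orthogonal projection onto the line `[z]`. -/
def coordFun {n : ℕ} [NeZero n] (i j : Fin n) : CP n → ℂ :=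
  Quotient.lift (fun g : U n => g.1 i 0 * conj (g.1 j 0)) (by
    intro g h hgh
    have hk : g⁻¹ * h ∈ blockSubgroup n := QuotientGroup.leftRel_apply.1 hgh
    have e : h = g * (g⁻¹ * h) := by group
    change g.1 i 0 * conj (g.1 j 0) = h.1 i 0 * conj (h.1 j 0)
    rw [e, mul_apply_zero_of_mem g hk, mul_apply_zero_of_mem g hk, map_mul, mul_mul_mul_comm,
      norm_corner_of_mem hk, mul_one])

theorem continuous_entry {n : ℕ} (i j : Fin n) : Continuous fun g : U n => g.1 i j :=
  (continuous_apply_apply i j).comp continuous_subtype_val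

/-- `coordFun i j` as a continuous function. -/
def coord {n : ℕ} [NeZero n] (i j : Fin n) : C(CP n, ℂ) where
  toFun := coordFun i j
  continuous_toFun := by
    refine Continuous.quotient_lift ?_ _
    exact (continuous_entry i 0).mul (Complex.continuous_conj.comp (continuous_entry j 0))

theorem coord_mk {n : ℕ} [NeZero n] (i j : Fin n) (g : U n) :
    coord i j (QuotientGroup.mk g : CP n) = g.1 i 0 * conj (g.1 j 0) := rfl

theorem inv_mul_apply_zero_of_coord_eq {n : ℕ} [NeZero n] {g h : U n}
    (H : ∀ i j, g.1 i 0 * conj (g.1 j 0) = h.1 i 0 * conj (h.1 j 0)) {i : Fin n} (hi : i ≠ 0) :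
    (h⁻¹ * g).1 i 0 = 0 := by
  change ((h⁻¹).1 * g.1) i 0 = 0
  rw [Matrix.mul_apply]
  -- It suffices to show the vanishing after multiplication by a nonzero entry.
  obtain ⟨l, hl⟩ : ∃ l, g.1 l 0 ≠ 0 := by
    by_contra! hc
    have := sum_conj_mul_col g 0 0
    simp [hc] at this
  have hl' : conj (g.1 l 0) ≠ 0 := by simpa using hl
  refine (mul_eq_zero.1 ?_).resolve_right hl'
  rw [Finset.sum_mul]
  have : ∀ k, (h⁻¹).1 i k * g.1 k 0 * conj (g.1 l 0)
      = conj (h.1 k i) * h.1 k 0 * conj (h.1 l 0) := by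
    intro k
    rw [mul_assoc, H, coe_inv_apply, mul_assoc]
  simp_rw [this]
  rw [← Finset.sum_mul, sum_conj_mul_col, if_neg hi, zero_mul]

/-- A point of projective space is determined by its coordinate functions. -/
theorem coord_separates {n : ℕ} [NeZero n] {x y : CP n} (H : ∀ i j, coord i j x = coord i j y) :
    x = y := by
  induction x using QuotientGroup.induction_on with | _ g
  induction y using QuotientGroup.induction_on with | _ h
  simp only [coord_mk] at H
  refine QuotientGroup.eq.2 (mem_blockSubgroup_iff.2 fun j hj => ⟨?_, ?_⟩)
  · have := inv_mul_apply_zero_of_coord_eq H hj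
    have e : g⁻¹ * h = (h⁻¹ * g)⁻¹ := by group
    rw [e, coe_inv_apply, this, map_zero]
  · exact inv_mul_apply_zero_of_coord_eq (fun i j => (H i j).symm) hj

theorem coord_smul {n : ℕ} [NeZero n] (i j : Fin n) (g : U n) (x : CP n) :
    coord i j (g • x) = ∑ k, ∑ l, g.1 i k * conj (g.1 j l) * coord k l x := by
  induction x using QuotientGroup.induction_on with | _ h
  change (g.1 * h.1) i 0 * conj ((g.1 * h.1) j 0) = _
  simp only [Matrix.mul_apply, map_sum, map_mul, Finset.sum_mul_sum, coord_mk]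
  refine Finset.sum_congr rfl fun k _ => Finset.sum_congr rfl fun l _ => by ring

theorem star_coord {n : ℕ} [NeZero n] (i j : Fin n) :
    star (coord i j : C(CP n, ℂ)) = coord j i := by
  ext x
  induction x using QuotientGroup.induction_on with | _ h
  simp [coord_mk, mul_comm]

theorem sum_coord_diag {n : ℕ} [NeZero n] : ∑ i, (coord i i : C(CP n, ℂ)) = 1 := by
  ext x
  induction x using QuotientGroup.induction_on with | _ h
  have := sum_conj_mul_col h 0 0
  simpa [coord_mk, mul_comm] using this

theorem coord_mul_coord {n : ℕ} [NeZero n] (i j k l : Fin n) :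
    (coord i j : C(CP n, ℂ)) * coord k l = coord i l * coord k j := by
  ext x
  induction x using QuotientGroup.induction_on with | _ h
  simp only [ContinuousMap.mul_apply, coord_mk]
  ring

/-- Unit vectors which are pairwise orthogonal are columns of some unitary matrix. -/
theorem exists_unitary_cols {n : ℕ} (s : Set (Fin n)) (u : Fin n → Fin n → ℂ)
    (hu : ∀ i ∈ s, ∀ j ∈ s, ∑ k, conj (u i k) * u j k = if i = j then 1 else 0) :
    ∃ g : U n, ∀ i, ∀ j ∈ s, g.1 i j = u j i := by
  let v : Fin n → EuclideanSpace ℂ (Fin n) := fun i => WithLp.toLp 2 (u i)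
  have hv : Orthonormal ℂ (s.domRestrict v) := by
    rw [orthonormal_iff_ite]
    rintro ⟨i, hi⟩ ⟨j, hj⟩
    have := hu i hi j hj
    simp only [EuclideanSpace.inner_eq_star_dotProduct, dotProduct, Subtype.mk.injEq]
    rw [← this]
    exact Finset.sum_congr rfl fun k _ => mul_comm _ _
  obtain ⟨b, hb⟩ := hv.exists_orthonormalBasis_extension_of_card_eq (by simp)
  refine ⟨⟨Matrix.of fun i j => b j i, ?_⟩, fun i j hj => ?_⟩
  · rw [Matrix.mem_unitaryGroup_iff']
    ext i j
    have := orthonormal_iff_ite.1 b.orthonormal i j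
    rw [EuclideanSpace.inner_eq_star_dotProduct] at this
    rw [Matrix.one_apply, ← this, Matrix.mul_apply, dotProduct]
    exact Finset.sum_congr rfl fun k _ => by simp [Matrix.star_apply, mul_comm]
  · simp [hb j hj, v]

theorem exists_point {n : ℕ} [NeZero n] (z : Fin n → ℂ) (hz : ∑ k, conj (z k) * z k = 1) :
    ∃ x : CP n, ∀ i j, coord i j x = z i * conj (z j) := by
  obtain ⟨g, hg⟩ := exists_unitary_cols {0} (fun _ => z) (by
    rintro i rfl j rfl
    simpa using hz)
  exact ⟨QuotientGroup.mk g, fun i j => by simp [coord_mk, hg]⟩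

theorem exists_rep {n : ℕ} [NeZero n] (x : CP n) :
    ∃ z : Fin n → ℂ, ∑ k, conj (z k) * z k = 1 ∧ ∀ i j, coord i j x = z i * conj (z j) := by
  induction x using QuotientGroup.induction_on with | _ g
  exact ⟨fun i => g.1 i 0, by simpa using sum_conj_mul_col g 0 0, fun i j => coord_mk i j g⟩

instance (n : ℕ) [NeZero n] : T2Space (CP n) := by
  refine T2Space.of_injective_continuous
    (f := fun (x : CP n) (p : Fin n × Fin n) => coord p.1 p.2 x)
    (fun x y h => coord_separates fun i j => congrFun h (i, j)) ?_
  exact continuous_pi fun p => (coord p.1 p.2).continuous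

-- With this instance, the quotient σ-algebra on projective space is the Borel σ-algebra.
instance (n : ℕ) : PolishSpace (U n) := by
  have : PolishSpace (Matrix (Fin n) (Fin n) ℂ) :=
    inferInstanceAs (PolishSpace (Fin n → Fin n → ℂ))
  have hc : IsClosed {A : Matrix (Fin n) (Fin n) ℂ | A * star A = 1} :=
    isClosed_eq (by fun_prop) (by fun_prop)
  have he : (Matrix.unitaryGroup (Fin n) ℂ : Set (Matrix (Fin n) (Fin n) ℂ))
      = {A : Matrix (Fin n) (Fin n) ℂ | A * star A = 1} := by
    ext A
    exact Matrix.mem_unitaryGroup_iff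
  rw [← he] at hc
  exact hc.polishSpace

instance (n : ℕ) [NeZero n] : (invMeasure n).IsOpenPosMeasure :=
  QuotientGroup.continuous_mk.isOpenPosMeasure_map QuotientGroup.mk_surjective

instance (n : ℕ) [NeZero n] : (invMeasure n).WeaklyRegular := by
  let := TopologicalSpace.metrizableSpaceMetric (CP n)
  infer_instance

/-! ### The filtration by degree and its orthogonal graded pieces -/

/-- The left regular representation `(g • f)(x) = f(g⁻¹ x)` on continuous functions. -/
def act {n : ℕ} (g : U n) : C(CP n, ℂ) →ₐ[ℂ] C(CP n, ℂ) :=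
  ContinuousMap.compRightAlgHom ℂ ℂ ⟨fun x => g⁻¹ • x, continuous_const_smul _⟩

theorem act_apply {n : ℕ} (g : U n) (f : C(CP n, ℂ)) (x : CP n) : act g f x = f (g⁻¹ • x) := rfl

theorem act_mul {n : ℕ} (g h : U n) (f : C(CP n, ℂ)) : act (g * h) f = act g (act h f) := by
  ext x
  simp [act_apply, mul_smul]

theorem act_one {n : ℕ} (f : C(CP n, ℂ)) : act 1 f = f := by
  ext x
  simp [act_apply]

theorem act_inv_act {n : ℕ} (g : U n) (f : C(CP n, ℂ)) : act g⁻¹ (act g f) = f := by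
  rw [← act_mul, inv_mul_cancel, act_one]

theorem act_act_inv {n : ℕ} (g : U n) (f : C(CP n, ℂ)) : act g (act g⁻¹ f) = f := by
  rw [← act_mul, mul_inv_cancel, act_one]

section

variable {n : ℕ} [NeZero n]

theorem act_coord (g : U n) (i j : Fin n) :
    act g (coord i j) = ∑ k, ∑ l, (conj (g.1 k i) * g.1 l j) • coord k l := by
  ext x
  rw [act_apply, coord_smul]
  simp [coe_inv_apply, ContinuousMap.sum_apply]

variable (n) in
/-- The span of the coordinate functions. Its `k`-th power is the space of restrictions to the unit
sphere of the polynomials of bidegree `(k, k)` in `z` and `z̄`. -/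
def linForms : Submodule ℂ C(CP n, ℂ) :=
  Submodule.span ℂ (Set.range fun p : Fin n × Fin n => coord p.1 p.2)

theorem coord_mem (i j : Fin n) : coord i j ∈ linForms n :=
  Submodule.subset_span ⟨(i, j), rfl⟩

theorem one_le_linForms : 1 ≤ linForms n := by
  rw [Submodule.one_le, ← sum_coord_diag]
  exact Submodule.sum_mem _ fun i _ => coord_mem i i

theorem linForms_pow_mono {j k : ℕ} (h : j ≤ k) : linForms n ^ j ≤ linForms n ^ k :=
  pow_le_pow_right' (M := Submodule ℂ C(CP n, ℂ)) one_le_linForms h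

theorem map_act_linForms_le (g : U n) : (linForms n).map (act g).toLinearMap ≤ linForms n := by
  rw [linForms, Submodule.map_span_le]
  rintro _ ⟨p, rfl⟩
  change act g (coord _ _) ∈ _
  rw [act_coord]
  exact Submodule.sum_mem _ fun k _ => Submodule.sum_mem _ fun l _ =>
    Submodule.smul_mem _ _ (coord_mem k l)

theorem act_mem_pow (g : U n) {k : ℕ} {f : C(CP n, ℂ)} (hf : f ∈ linForms n ^ k) :
    act g f ∈ linForms n ^ k := by
  have h : (linForms n ^ k).map (act g).toLinearMap ≤ linForms n ^ k := by
    rw [Submodule.map_pow]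
    exact pow_le_pow_left' (map_act_linForms_le g) k
  exact h (Submodule.mem_map_of_mem hf)

instance (k : ℕ) : FiniteDimensional ℂ ↥(linForms n ^ k) :=
  Module.Finite.iff_fg.2 ((Submodule.fg_span (Set.finite_range _)).pow k)

variable (n) in
/-- The inclusion of the continuous functions into `L²`. -/
def toL2 : C(CP n, ℂ) →L[ℂ] L2CP n := ContinuousMap.toLp 2 (invMeasure n) ℂ

theorem toL2_injective : Function.Injective (toL2 n) := ContinuousMap.toLp_injective _

theorem inner_toL2 (f g : C(CP n, ℂ)) :
    inner ℂ (toL2 n f) (toL2 n g) = ∫ x, g x * conj (f x) ∂invMeasure n :=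
  ContinuousMap.inner_toLp _ f g

theorem eq_zero_of_inner_self {f : C(CP n, ℂ)} (h : inner ℂ (toL2 n f) (toL2 n f) = 0) : f = 0 :=
  toL2_injective (by rw [inner_self_eq_zero.1 h, map_zero])

theorem inner_act_act (g : U n) (f h : C(CP n, ℂ)) :
    inner ℂ (toL2 n (act g f)) (toL2 n (act g h)) = inner ℂ (toL2 n f) (toL2 n h) := by
  rw [inner_toL2, inner_toL2]
  have hmp := invMeasure_measurePreserving n g⁻¹
  conv_rhs => rw [← hmp.map_eq]
  rw [integral_map hmp.measurable.aemeasurable]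
  · rfl
  · exact (by fun_prop : Continuous fun x => h x * conj (f x)).aestronglyMeasurable

/-- Orthogonal projection, for the `L²` inner product, onto a finite-dimensional space of continuous
functions. -/
theorem exists_mem_inner_sub_eq_zero (N : Submodule ℂ C(CP n, ℂ)) [FiniteDimensional ℂ N]
    (f : C(CP n, ℂ)) : ∃ h ∈ N, ∀ g ∈ N, inner ℂ (toL2 n g) (toL2 n (f - h)) = 0 := by
  let M : Submodule ℂ (L2CP n) := N.map (toL2 n).toLinearMap
  have : FiniteDimensional ℂ M := inferInstance
  obtain ⟨h, hN, hh⟩ := Submodule.mem_map.1 (M.starProjection_apply_mem (toL2 n f))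
  refine ⟨h, hN, fun g hg => ?_⟩
  have h1 := M.sub_starProjection_mem_orthogonal (toL2 n f)
  rw [map_sub]
  change toL2 n h = _ at hh
  rw [hh]
  exact h1 _ (Submodule.mem_map_of_mem hg)

variable (n) in
/-- The functions of degree `k` which are orthogonal to all functions of smaller degree; these are
the restrictions to the unit sphere of the harmonic polynomials of bidegree `(k, k)`. -/
def harmonic (k : ℕ) : Submodule ℂ C(CP n, ℂ) where
  carrier := {f | f ∈ linForms n ^ k ∧
    ∀ j < k, ∀ h ∈ linForms n ^ j, inner ℂ (toL2 n h) (toL2 n f) = 0}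
  add_mem' := by
    rintro f g ⟨hf, hf'⟩ ⟨hg, hg'⟩
    refine ⟨add_mem hf hg, fun j hj h hh => ?_⟩
    rw [map_add, inner_add_right, hf' j hj h hh, hg' j hj h hh, add_zero]
  zero_mem' := ⟨zero_mem _, fun j hj h hh => by simp⟩
  smul_mem' := by
    rintro c f ⟨hf, hf'⟩
    refine ⟨Submodule.smul_mem _ c hf, fun j hj h hh => ?_⟩
    rw [map_smul, inner_smul_right, hf' j hj h hh, mul_zero]

theorem harmonic_le_pow (k : ℕ) : harmonic n k ≤ linForms n ^ k := fun _ h => h.1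

instance (k : ℕ) : FiniteDimensional ℂ ↥(harmonic n k) :=
  Submodule.finiteDimensional_of_le (harmonic_le_pow k)

theorem act_mem_harmonic (g : U n) {k : ℕ} {f : C(CP n, ℂ)} (hf : f ∈ harmonic n k) :
    act g f ∈ harmonic n k := by
  refine ⟨act_mem_pow g hf.1, fun j hj h hh => ?_⟩
  rw [← act_act_inv g h, inner_act_act]
  exact hf.2 j hj _ (act_mem_pow _ hh)

theorem pow_succ_le_sup_harmonic (k : ℕ) :
    linForms n ^ (k + 1) ≤ linForms n ^ k ⊔ harmonic n (k + 1) := by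
  intro f hf
  obtain ⟨h, hh, ho⟩ := exists_mem_inner_sub_eq_zero (linForms n ^ k) f
  rw [← add_sub_cancel h f]
  refine Submodule.add_mem_sup hh ⟨sub_mem hf (linForms_pow_mono (Nat.le_succ k) hh), ?_⟩
  intro j hj g hg
  exact ho g (linForms_pow_mono (Nat.le_of_lt_succ hj) hg)

theorem pow_zero_le_harmonic : linForms n ^ 0 ≤ harmonic n 0 :=
  fun _ hf => ⟨hf, fun _ hj => absurd hj (Nat.not_lt_zero _)⟩

theorem pow_le_iSup_harmonic (k : ℕ) : linForms n ^ k ≤ ⨆ j ≤ k, harmonic n j := by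
  induction k with
  | zero => exact pow_zero_le_harmonic.trans (le_iSup₂_of_le 0 le_rfl le_rfl)
  | succ k ih =>
    refine (pow_succ_le_sup_harmonic k).trans
      (sup_le (ih.trans ?_) (le_iSup₂_of_le _ le_rfl le_rfl))
    exact iSup₂_le fun j hj => le_iSup₂_of_le j (hj.trans (Nat.le_succ k)) le_rfl

/-- Functions of degree `k` are harmonic of degree `k` up to functions of smaller degree. -/
theorem exists_harmonic_add {k : ℕ} {f : C(CP n, ℂ)} (hf : f ∈ linForms n ^ k) :
    ∃ h ∈ harmonic n k, f - h = 0 ∨ ∃ j < k, f - h ∈ linForms n ^ j := by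
  cases k with
  | zero => exact ⟨f, pow_zero_le_harmonic hf, Or.inl (sub_self f)⟩
  | succ k =>
    obtain ⟨h, hh, g, hg, rfl⟩ := Submodule.mem_sup.1 (pow_succ_le_sup_harmonic k hf)
    exact ⟨g, hg, Or.inr ⟨k, Nat.lt_succ_self k, by simpa using hh⟩⟩

theorem inner_eq_zero_of_mem_harmonic {k : ℕ} {f h : C(CP n, ℂ)} (hf : f ∈ harmonic n k)
    (hh : h = 0 ∨ ∃ j < k, h ∈ linForms n ^ j) : inner ℂ (toL2 n f) (toL2 n h) = 0 := by
  rcases hh with rfl | ⟨j, hj, hh⟩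
  · simp
  · exact inner_eq_zero_symm.1 (hf.2 j hj h hh)

theorem star_mem_linForms {f : C(CP n, ℂ)} (hf : f ∈ linForms n) : star f ∈ linForms n := by
  rw [linForms] at hf
  induction hf using Submodule.span_induction with
  | mem x h =>
    obtain ⟨p, rfl⟩ := h
    exact (star_coord p.1 p.2).symm ▸ coord_mem p.2 p.1
  | zero => simp
  | add x y _ _ hx hy => rw [star_add]; exact add_mem hx hy
  | smul a x _ hx => rw [star_smul]; exact Submodule.smul_mem _ _ hx

theorem star_mem_pow {k : ℕ} {f : C(CP n, ℂ)} (hf : f ∈ linForms n ^ k) :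
    star f ∈ linForms n ^ k := by
  induction hf using Submodule.pow_induction_on_left' with
  | algebraMap r =>
    rw [← algebraMap_star_comm]
    exact Submodule.algebraMap_mem _
  | add x y i _ _ hx hy => rw [star_add]; exact add_mem hx hy
  | mem_mul m hm i x _ hx =>
    rw [star_mul', pow_succ' (M := Submodule ℂ C(CP n, ℂ))]
    exact Submodule.mul_mem_mul (star_mem_linForms hm) hx

variable (n) in
/-- The functions of arbitrary degree form a star subalgebra of the continuous functions. -/
def polyAlgebra : StarSubalgebra ℂ C(CP n, ℂ) where
  carrier := {f | ∃ k, f ∈ linForms n ^ k}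
  mul_mem' := by
    rintro f g ⟨k, hf⟩ ⟨l, hg⟩
    refine ⟨k + l, ?_⟩
    rw [pow_add (M := Submodule ℂ C(CP n, ℂ))]
    exact Submodule.mul_mem_mul hf hg
  add_mem' := by
    rintro f g ⟨k, hf⟩ ⟨l, hg⟩
    exact ⟨max k l, add_mem (linForms_pow_mono (le_max_left k l) hf)
      (linForms_pow_mono (le_max_right k l) hg)⟩
  algebraMap_mem' r := ⟨0, by
    rw [pow_zero (M := Submodule ℂ C(CP n, ℂ))]
    exact Submodule.algebraMap_mem r⟩
  star_mem' := by
    rintro f ⟨k, hf⟩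
    exact ⟨k, star_mem_pow hf⟩

/-- By the Stone–Weierstrass theorem, a bounded operator on the continuous functions vanishes if it
vanishes on the functions of every degree. -/
theorem eq_zero_of_forall_pow {E : Type*} [NormedAddCommGroup E] [NormedSpace ℂ E]
    (T : C(CP n, ℂ) →L[ℂ] E) (hT : ∀ k, ∀ f ∈ linForms n ^ k, T f = 0) (f : C(CP n, ℂ)) :
    T f = 0 := by
  have hd : (polyAlgebra n).topologicalClosure = ⊤ := by
    refine ContinuousMap.starSubalgebra_topologicalClosure_eq_top_of_separatesPoints _ ?_
    intro x y hxy
    by_contra! hc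
    refine hxy (coord_separates fun i j => hc _ ⟨coord i j, ⟨1, ?_⟩, rfl⟩)
    rw [pow_one (M := Submodule ℂ C(CP n, ℂ))]
    exact coord_mem i j
  have hf : f ∈ closure (polyAlgebra n : Set C(CP n, ℂ)) := by
    have : f ∈ (polyAlgebra n).topologicalClosure := by rw [hd]; trivial
    exact this
  have hsub : closure (polyAlgebra n : Set C(CP n, ℂ)) ⊆ {f | T f = 0} :=
    closure_minimal (fun g ⟨k, hg⟩ => hT k g hg) (isClosed_eq T.continuous continuous_const)
  exact hsub hf

/-! ### Zonal functions -/

/-- The vector `(c, 0, …, s, …, 0)` with `s` in position `j`. -/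
def meridian (j : Fin n) (c s : ℂ) (i : Fin n) : ℂ := if i = 0 then c else if i = j then s else 0

theorem sum_mul_meridian {j : Fin n} (hj : j ≠ 0) (a : Fin n → ℂ) (c s : ℂ) :
    ∑ i, a i * meridian j c s i = a 0 * c + a j * s := by
  have : ∀ i, a i * meridian j c s i
      = (if i = 0 then a i * c else 0) + if i = j then a i * s else 0 := by
    intro i
    unfold meridian
    by_cases h0 : i = 0
    · subst h0; simp [hj.symm]
    · simp [h0]
  simp [this, Finset.sum_add_distrib]

theorem coord_smul_of_rep {x : CP n} {z : Fin n → ℂ} (hz : ∀ i j, coord i j x = z i * conj (z j))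
    (g : U n) (i j : Fin n) :
    coord i j (g • x) = (∑ k, g.1 i k * z k) * conj (∑ k, g.1 j k * z k) := by
  rw [coord_smul, map_sum, Finset.sum_mul_sum]
  refine Finset.sum_congr rfl fun k _ => Finset.sum_congr rfl fun l _ => ?_
  rw [hz, map_mul]
  ring

/-- Every orbit of the block subgroup meets the meridian through the base point. -/
theorem exists_mem_blockSubgroup_smul {j : Fin n} (hj : j ≠ 0) {x y : CP n} {z : Fin n → ℂ}
    (hz1 : ∑ k, conj (z k) * z k = 1) (hx : ∀ i j, coord i j x = z i * conj (z j)) {c s : ℝ}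
    (hcz : ‖z 0‖ = c) (hcs : c ^ 2 + s ^ 2 = 1)
    (hy : ∀ i l, coord i l y = meridian j c s i * conj (meridian j c s l)) :
    ∃ k ∈ blockSubgroup n, x = k • y := by
  -- The phase which makes the first coordinate of `z` equal to `c`.
  obtain ⟨u, hu1, hu⟩ : ∃ u : ℂ, conj u * u = 1 ∧ u * z 0 = c := by
    by_cases h0 : z 0 = 0
    · exact ⟨1, by simp, by rw [← hcz]; simp [h0]⟩
    · have hn : (‖z 0‖ : ℂ) ≠ 0 := by simpa using h0
      have hm : conj (z 0) * z 0 = (‖z 0‖ : ℂ) ^ 2 := Complex.conj_mul' (z 0)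
      refine ⟨conj (z 0) / ‖z 0‖, ?_, ?_⟩
      · rw [map_div₀, Complex.conj_conj, Complex.conj_ofReal]
        field_simp
        rw [mul_comm, hm]
      · rw [← hcz]
        field_simp
        exact hm
  have hrest : ∑ k ∈ Finset.univ.erase 0, conj (u * z k) * (u * z k) = (s : ℂ) ^ 2 := by
    have h1 : ∑ k, conj (u * z k) * (u * z k) = 1 := by
      rw [← hz1]
      refine Finset.sum_congr rfl fun k _ => ?_
      rw [map_mul, mul_mul_mul_comm, hu1, one_mul]
    rw [← Finset.add_sum_erase _ _ (Finset.mem_univ 0), hu, Complex.conj_ofReal] at h1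
    have h2 : (c : ℂ) ^ 2 + (s : ℂ) ^ 2 = 1 := by exact_mod_cast hcs
    linear_combination h1 - h2
  -- A unit vector orthogonal to `e₁` with `u z = c e₁ + s w`; any choice will do if `s = 0`.
  obtain ⟨w, hw0, hw1, hw⟩ : ∃ w : Fin n → ℂ, w 0 = 0 ∧ ∑ k, conj (w k) * w k = 1 ∧
      ∀ k, k ≠ 0 → w k * s = u * z k := by
    by_cases h0 : s = 0
    · refine ⟨Pi.single j 1, by simp [hj.symm], ?_, fun k hk => ?_⟩
      · rw [Finset.sum_eq_single j] <;> simp +contextual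
      · have h3 : ∑ k ∈ Finset.univ.erase 0, ‖u * z k‖ ^ 2 = (0 : ℝ) := by
          rw [h0] at hrest
          have : ((∑ k ∈ Finset.univ.erase 0, ‖u * z k‖ ^ 2 : ℝ) : ℂ) = 0 := by
            push_cast
            rw [← show ((0 : ℝ) : ℂ) ^ 2 = 0 by simp, ← hrest]
            exact Finset.sum_congr rfl fun k _ => (Complex.conj_mul' _).symm
          exact_mod_cast this
        have h4 := (Finset.sum_eq_zero_iff_of_nonneg fun k _ => by positivity).1 h3 k
          (Finset.mem_erase.2 ⟨hk, Finset.mem_univ k⟩)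
        have h5 : u * z k = 0 := by simpa using h4
        rw [h5, h0]
        simp
    · have h0' : (s : ℂ) ≠ 0 := by exact_mod_cast h0
      refine ⟨fun k => if k = 0 then 0 else u * z k / s, by simp, ?_, fun k hk => ?_⟩
      · rw [← Finset.add_sum_erase _ _ (Finset.mem_univ 0)]
        simp only [if_true, mul_zero, zero_add]
        have : ∀ k ∈ Finset.univ.erase (0 : Fin n),
            conj (if k = 0 then 0 else u * z k / s) * (if k = 0 then 0 else u * z k / s)
              = conj (u * z k) * (u * z k) / (s : ℂ) ^ 2 := by
          intro k hk
          rw [if_neg (Finset.mem_erase.1 hk).1, map_div₀, Complex.conj_ofReal]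
          field_simp
        rw [Finset.sum_congr rfl this, ← Finset.sum_div, hrest]
        field_simp
      · simp only [if_neg hk]
        field_simp
  -- The unitary matrix which fixes `e₁` and maps the `j`-th basis vector to `w`.
  obtain ⟨k, hk⟩ := exists_unitary_cols {0, j}
    (fun i => if i = 0 then Pi.single 0 1 else w) (by
      have h00 : ∀ a : Fin n → ℂ, ∑ k, conj ((Pi.single 0 1 : Fin n → ℂ) k) * a k = a 0 := by
        intro a
        rw [Finset.sum_eq_single 0] <;> simp +contextual
      have h01 : ∀ a : Fin n → ℂ, ∑ k, a k * (Pi.single 0 1 : Fin n → ℂ) k = a 0 := by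
        intro a
        rw [Finset.sum_eq_single 0] <;> simp +contextual
      rintro i (rfl | rfl) l (rfl | rfl)
      · simp [h00]
      · simp [h00, hj, hj.symm, hw0]
      · simp [h01 (fun k => conj (w k)), hj, hw0]
      · simpa [hj] using hw1)
  have hk0 : ∀ i, k.1 i 0 = (Pi.single 0 1 : Fin n → ℂ) i := fun i => by
    rw [hk i 0 (by simp)]; simp
  have hkj : ∀ i, k.1 i j = w i := fun i => by
    rw [hk i j (by simp)]; simp [hj]
  refine ⟨k, mem_blockSubgroup_iff.2 fun i hi => ⟨?_, by rw [hk0]; simp [hi]⟩, ?_⟩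
  · -- The first row vanishes off the diagonal, being orthogonal to the first column `e₁`.
    have h := sum_conj_mul_col k 0 i
    rw [if_neg hi.symm, Finset.sum_eq_single 0] at h
    · simpa [hk0] using h
    · intro b _ hb
      simp [hk0, hb]
    · simp
  · refine coord_separates fun i l => ?_
    have hval : ∀ i, ∑ r, k.1 i r * meridian j c s r = u * z i := by
      intro i
      rw [sum_mul_meridian hj, hk0, hkj]
      by_cases hi : i = 0
      · subst hi; simp [hw0, hu]
      · simp [hi, hw i hi]
    rw [coord_smul_of_rep hy, hval, hval, hx, map_mul]
    linear_combination (-(z i * conj (z l))) * hu1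

theorem linForms_on_meridian {j : Fin n} (hj : j ≠ 0) {f : C(CP n, ℂ)} (hf : f ∈ linForms n) :
    ∃ α β γ : ℂ, ∀ (c s : ℝ) (y : CP n), c ^ 2 + s ^ 2 = 1 →
      (∀ i l, coord i l y = meridian j c s i * conj (meridian j c s l)) →
      f y = α + β * (c : ℂ) ^ 2 + γ * (c * s) := by
  rw [linForms] at hf
  induction hf using Submodule.span_induction with
  | mem x h =>
    obtain ⟨⟨a, b⟩, rfl⟩ := h
    have hs : ∀ c s : ℝ, c ^ 2 + s ^ 2 = 1 → (s : ℂ) ^ 2 = 1 - (c : ℂ) ^ 2 := by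
      intro c s h
      have h2 : (c : ℂ) ^ 2 + (s : ℂ) ^ 2 = 1 := by exact_mod_cast h
      linear_combination h2
    by_cases ha : a = 0 <;> by_cases hb : b = 0
    · refine ⟨0, 1, 0, fun c s y _ hy => ?_⟩
      simp [hy, meridian, ha, hb, sq]
    · by_cases hb' : b = j
      · refine ⟨0, 0, 1, fun c s y _ hy => ?_⟩
        simp [hy, meridian, ha, hb', hj]
      · refine ⟨0, 0, 0, fun c s y _ hy => ?_⟩
        simp [hy, meridian, hb, hb']
    · by_cases ha' : a = j
      · refine ⟨0, 0, 1, fun c s y _ hy => ?_⟩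
        simp [hy, meridian, hb, ha', hj, mul_comm]
      · refine ⟨0, 0, 0, fun c s y _ hy => ?_⟩
        simp [hy, meridian, ha, ha']
    · by_cases ha' : a = j
      · by_cases hb' : b = j
        · refine ⟨1, -1, 0, fun c s y h hy => ?_⟩
          have := hs c s h
          simp [hy, meridian, hb', ha', hj]
          linear_combination this
        · refine ⟨0, 0, 0, fun c s y _ hy => ?_⟩
          simp [hy, meridian, hb, hb']
      · refine ⟨0, 0, 0, fun c s y _ hy => ?_⟩
        simp [hy, meridian, ha, ha']
  | zero => exact ⟨0, 0, 0, fun c s y _ _ => by simp⟩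
  | add f g _ _ hf hg =>
    obtain ⟨α, β, γ, h⟩ := hf
    obtain ⟨α', β', γ', h'⟩ := hg
    refine ⟨α + α', β + β', γ + γ', fun c s y hcs hy => ?_⟩
    rw [ContinuousMap.add_apply, h c s y hcs hy, h' c s y hcs hy]
    ring
  | smul a f _ hf =>
    obtain ⟨α, β, γ, h⟩ := hf
    refine ⟨a * α, a * β, a * γ, fun c s y hcs hy => ?_⟩
    rw [ContinuousMap.smul_apply, h c s y hcs hy, smul_eq_mul]
    ring

open Polynomial in
/-- On the meridian `(c, s)`, `c² + s² = 1`, a function of degree `k` is a polynomial in `c²` of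
degree at most `k` plus `cs` times a polynomial in `c²` of degree less than `k`. -/
theorem pow_on_meridian {j : Fin n} (hj : j ≠ 0) {k : ℕ} {f : C(CP n, ℂ)}
    (hf : f ∈ linForms n ^ k) :
    ∃ p ∈ degreeLT ℂ (k + 1), ∃ q ∈ degreeLT ℂ k, ∀ (c s : ℝ) (y : CP n), c ^ 2 + s ^ 2 = 1 →
      (∀ i l, coord i l y = meridian j c s i * conj (meridian j c s l)) →
      f y = p.eval ((c : ℂ) ^ 2) + c * s * q.eval ((c : ℂ) ^ 2) := by
  induction hf using Submodule.pow_induction_on_left' with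
  | algebraMap r =>
    refine ⟨C r, ?_, 0, zero_mem _, fun c s y _ _ => by simp⟩
    rw [mem_degreeLT]
    exact degree_C_le.trans_lt (by norm_num)
  | add f g i _ _ hf hg =>
    obtain ⟨p, hp, q, hq, h⟩ := hf
    obtain ⟨p', hp', q', hq', h'⟩ := hg
    refine ⟨p + p', add_mem hp hp', q + q', add_mem hq hq', fun c s y hcs hy => ?_⟩
    rw [ContinuousMap.add_apply, h c s y hcs hy, h' c s y hcs hy, eval_add, eval_add]
    ring
  | mem_mul m hm i f _ hf =>
    obtain ⟨α, β, γ, hm⟩ := linForms_on_meridian hj hm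
    obtain ⟨p, hp, q, hq, h⟩ := hf
    have hmul : ∀ {r : ℂ[X]} {d e : ℕ} (t : ℂ[X]), r ∈ degreeLT ℂ d → t.natDegree ≤ e →
        t * r ∈ degreeLT ℂ (d + e) := by
      intro r d e t hr ht
      by_cases hr0 : r = 0
      · simp [hr0]
      by_cases ht0 : t = 0
      · simp [ht0]
      rw [mem_degreeLT, degree_mul, degree_eq_natDegree hr0, degree_eq_natDegree ht0] at *
      norm_cast at *
      omega
    -- The products `cs · cs` are rewritten by `s² = 1 - c²`.
    have hlin : (C α + C β * X : ℂ[X]).natDegree ≤ 1 := by compute_degree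
    have hquad : (C γ * (X * (1 - X)) : ℂ[X]).natDegree ≤ 2 := by compute_degree
    have h1 : (C α + C β * X) * p ∈ degreeLT ℂ (i + 1 + 1) := hmul _ hp hlin
    have h2 : C γ * (X * (1 - X)) * q ∈ degreeLT ℂ (i + 2) := hmul _ hq hquad
    have h3 : (C α + C β * X) * q ∈ degreeLT ℂ (i + 1) := hmul _ hq hlin
    have h4 : C γ * p ∈ degreeLT ℂ (i + 1 + 0) := hmul _ hp (natDegree_C γ).le
    refine ⟨_, add_mem h1 h2, _, add_mem h3 h4, fun c s y hcs hy => ?_⟩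
    have h2 : (c : ℂ) ^ 2 + (s : ℂ) ^ 2 = 1 := by exact_mod_cast hcs
    rw [ContinuousMap.mul_apply, hm c s y hcs hy, h c s y hcs hy]
    simp only [eval_add, eval_mul, eval_C, eval_X, eval_sub, eval_one]
    linear_combination γ * c ^ 2 * eval ((c : ℂ) ^ 2) q * h2

open Polynomial in
/-- The functions of degree `k` fixed by the block subgroup are the polynomials of degree at most
`k` in the single function `|z₁|²`. -/
theorem exists_polynomial_of_fixed {j : Fin n} (hj : j ≠ 0) {k : ℕ} {f : C(CP n, ℂ)}
    (hf : f ∈ linForms n ^ k) (hfix : ∀ g ∈ blockSubgroup n, act g f = f) :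
    ∃ p ∈ degreeLT ℂ (k + 1), f = aeval (coord 0 0) p := by
  obtain ⟨p, hp, q, -, h⟩ := pow_on_meridian hj hf
  refine ⟨p, hp, ContinuousMap.ext fun x => ?_⟩
  have hfix' : ∀ g ∈ blockSubgroup n, ∀ y, f (g • y) = f y := by
    intro g hg y
    conv_lhs => rw [← hfix g hg]
    rw [act_apply, inv_smul_smul]
  obtain ⟨z, hz1, hz⟩ := exists_rep x
  have hle : ‖z 0‖ ^ 2 ≤ 1 := by
    have h1 : ∑ k, ‖z k‖ ^ 2 = 1 := by
      have : ((∑ k, ‖z k‖ ^ 2 : ℝ) : ℂ) = 1 := by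
        push_cast
        rw [← hz1]
        exact Finset.sum_congr rfl fun k _ => (Complex.conj_mul' _).symm
      exact_mod_cast this
    rw [← h1]
    exact Finset.single_le_sum (f := fun k => ‖z k‖ ^ 2) (fun k _ => by positivity)
      (Finset.mem_univ 0)
  let c : ℝ := ‖z 0‖
  let s : ℝ := Real.sqrt (1 - ‖z 0‖ ^ 2)
  have hcs : c ^ 2 + s ^ 2 = 1 := by
    rw [Real.sq_sqrt (by linarith)]
    ring
  have hunit : ∀ s' : ℝ, c ^ 2 + s' ^ 2 = 1 →
      ∑ k, conj (meridian j c s' k) * meridian j c s' k = 1 := by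
    intro s' h'
    have h2 : (c : ℂ) ^ 2 + (s' : ℂ) ^ 2 = 1 := by exact_mod_cast h'
    rw [sum_mul_meridian hj (fun k => conj (meridian j c s' k))]
    simp only [meridian, if_true, if_neg hj, Complex.conj_ofReal]
    linear_combination h2
  -- The points `(c, s)` and `(c, -s)` lie in the same orbit, so the part odd in `s` vanishes.
  have hcs' : c ^ 2 + (-s) ^ 2 = 1 := by rw [neg_sq]; exact hcs
  obtain ⟨y, hy⟩ := exists_point _ (hunit s hcs)
  obtain ⟨y', hy'⟩ := exists_point _ (hunit (-s) hcs')
  obtain ⟨g, hg, hxy⟩ := exists_mem_blockSubgroup_smul hj hz1 hz rfl hcs hy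
  obtain ⟨g', hg', hyy'⟩ := exists_mem_blockSubgroup_smul hj (hunit (-s) hcs') hy'
    (by simp [meridian, c]) hcs hy
  have e1 := h c s y hcs hy
  have e2 := h c (-s) y' hcs' hy'
  rw [hyy', hfix' g' hg', e1] at e2
  have e3 : coord 0 0 x = (c : ℂ) ^ 2 := by
    rw [hz, mul_comm]
    exact Complex.conj_mul' _
  have e4 : (aeval (coord 0 0 : C(CP n, ℂ)) p) x = p.eval (coord 0 0 x) := by
    rw [← ContinuousMap.evalAlgHom_apply ℂ, ← aeval_algHom_apply]
    exact (aeval_def _ _).trans rfl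
  rw [e4, e3, hxy, hfix' g hg, e1]
  push_cast at e2
  linear_combination e2 / 2

end

section

variable {n : ℕ}

/-! ### Irreducibility of the harmonic spaces -/

section

variable [NeZero n]

/-- A nonzero finite-dimensional invariant space of continuous functions contains a nonzero function
fixed by the block subgroup, namely the one which represents the evaluation at the base point. -/
theorem exists_fixed_mem (N : Submodule ℂ C(CP n, ℂ)) [FiniteDimensional ℂ N]
    (hN : ∀ g, ∀ f ∈ N, act g f ∈ N) (h0 : N ≠ ⊥) :
    ∃ φ ∈ N, φ ≠ 0 ∧ ∀ g ∈ blockSubgroup n, act g φ = φ := by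
  let o : CP n := QuotientGroup.mk 1
  have ho : ∀ g ∈ blockSubgroup n, g⁻¹ • o = o := by
    intro g hg
    refine QuotientGroup.eq.2 ?_
    simpa using hg
  let N₀ : Submodule ℂ C(CP n, ℂ) :=
    N ⊓ LinearMap.ker (ContinuousMap.evalAlgHom ℂ ℂ o).toLinearMap
  have hN₀ : ∀ f, f ∈ N₀ ↔ f ∈ N ∧ f o = 0 := fun f => Iff.rfl
  have : FiniteDimensional ℂ N₀ := Submodule.finiteDimensional_of_le inf_le_left
  obtain ⟨f, hf, hfo⟩ : ∃ f ∈ N, f o ≠ 0 := by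
    obtain ⟨f, hf, hf0⟩ := N.ne_bot_iff.1 h0
    obtain ⟨x, hx⟩ : ∃ x, f x ≠ 0 := by
      by_contra! hc
      exact hf0 (ContinuousMap.ext hc)
    induction x using QuotientGroup.induction_on with | _ g
    refine ⟨act g⁻¹ f, hN _ f hf, ?_⟩
    rw [act_apply, inv_inv]
    convert hx using 2
    change QuotientGroup.mk (g * 1) = _
    rw [mul_one]
  obtain ⟨h, hh, horth⟩ := exists_mem_inner_sub_eq_zero N₀ f
  have hmem : f - h ∈ N := sub_mem hf hh.1
  refine ⟨f - h, hmem, fun h0 => ?_, fun g hg => ?_⟩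
  · apply hfo
    rw [sub_eq_zero.1 h0]
    exact hh.2
  · -- The difference of `f - h` and its translate vanishes at `o` and is orthogonal to `N₀`.
    have hd : act g (f - h) - (f - h) ∈ N₀ := by
      refine (hN₀ _).2 ⟨sub_mem (hN g _ hmem) hmem, ?_⟩
      rw [ContinuousMap.sub_apply, act_apply, ho g hg, sub_self]
    refine sub_eq_zero.1 (eq_zero_of_inner_self ?_)
    have h1 : inner ℂ (toL2 n (act g (f - h) - (f - h))) (toL2 n (act g (f - h))) = 0 := by
      rw [← inner_act_act g⁻¹, act_inv_act]
      refine horth _ ((hN₀ _).2 ⟨hN _ _ hd.1, ?_⟩)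
      have hg' : g⁻¹⁻¹ • o = o := ho g⁻¹ (inv_mem hg)
      rw [act_apply, hg']
      exact hd.2
    conv_lhs => arg 3; rw [map_sub]
    rw [inner_sub_right, h1, horth _ hd, sub_zero]

open Polynomial in
/-- A harmonic function of degree `k` which is a polynomial of degree less than `k` in `|z₁|²` is
zero. -/
theorem eq_zero_of_mem_harmonic_of_degree_lt {k : ℕ} {p : ℂ[X]} (hp : p ∈ degreeLT ℂ k)
    (h : aeval (coord 0 0 : C(CP n, ℂ)) p ∈ harmonic n k) :
    aeval (coord 0 0 : C(CP n, ℂ)) p = 0 := by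
  refine eq_zero_of_inner_self (inner_eq_zero_of_mem_harmonic h ?_)
  cases k with
  | zero =>
    left
    have : p = 0 := by
      rw [mem_degreeLT] at hp
      exact degree_eq_bot.1 (Nat.WithBot.lt_zero_iff.1 hp)
    rw [this, map_zero]
  | succ k =>
    refine Or.inr ⟨k, k.lt_succ_self, ?_⟩
    rw [aeval_eq_sum_range]
    refine Submodule.sum_mem _ fun i hi => Submodule.smul_mem _ _ ?_
    by_cases hp0 : p = 0
    · rw [hp0] at hi
      have : i = 0 := by simpa using hi
      rw [this, pow_zero]
      exact Submodule.one_le.1 (one_le_pow_of_one_le' (M := Submodule ℂ C(CP n, ℂ))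
        one_le_linForms k)
    · have hik : i ≤ k := by
        rw [mem_degreeLT, degree_eq_natDegree hp0] at hp
        have := Nat.cast_lt.1 hp
        have := Finset.mem_range.1 hi
        omega
      exact linForms_pow_mono hik (Submodule.pow_mem_pow _ (coord_mem 0 0) i)

open Polynomial in
/-- The harmonic space of degree `k` is irreducible: its functions fixed by the block subgroup form
a line, and each of two complementary invariant subspaces would contribute one. -/
theorem eq_bot_or_eq_harmonic {j : Fin n} (hj : j ≠ 0) {k : ℕ} {N : Submodule ℂ C(CP n, ℂ)}
    (hle : N ≤ harmonic n k) (hN : ∀ g, ∀ f ∈ N, act g f ∈ N) : N = ⊥ ∨ N = harmonic n k := by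
  rw [or_iff_not_imp_left]
  intro h0
  have : FiniteDimensional ℂ N := Submodule.finiteDimensional_of_le hle
  let M : Submodule ℂ C(CP n, ℂ) :=
    { carrier := {f | f ∈ harmonic n k ∧ ∀ h ∈ N, inner ℂ (toL2 n h) (toL2 n f) = 0}
      add_mem' := by
        rintro f g ⟨hf, hf'⟩ ⟨hg, hg'⟩
        refine ⟨add_mem hf hg, fun h hh => ?_⟩
        rw [map_add, inner_add_right, hf' h hh, hg' h hh, add_zero]
      zero_mem' := ⟨zero_mem _, fun h hh => by simp⟩
      smul_mem' := by
        rintro c f ⟨hf, hf'⟩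
        refine ⟨Submodule.smul_mem _ c hf, fun h hh => ?_⟩
        rw [map_smul, inner_smul_right, hf' h hh, mul_zero] }
  have hMle : M ≤ harmonic n k := fun f hf => hf.1
  have : FiniteDimensional ℂ M := Submodule.finiteDimensional_of_le hMle
  have hM : ∀ g, ∀ f ∈ M, act g f ∈ M := by
    rintro g f ⟨hf, hf'⟩
    refine ⟨act_mem_harmonic g hf, fun h hh => ?_⟩
    rw [← act_act_inv g h, inner_act_act]
    exact hf' _ (hN _ _ hh)
  have hMbot : M = ⊥ := by
    by_contra hMb
    obtain ⟨φ, hφ, hφ0, hφf⟩ := exists_fixed_mem N hN h0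
    obtain ⟨ψ, hψ, hψ0, hψf⟩ := exists_fixed_mem M hM hMb
    obtain ⟨p, hp, hφp⟩ := exists_polynomial_of_fixed hj (harmonic_le_pow k (hle hφ)) hφf
    obtain ⟨q, hq, hψq⟩ := exists_polynomial_of_fixed hj (harmonic_le_pow k (hMle hψ)) hψf
    -- Subtract multiples of `φ` and `ψ` so as to cancel the terms of degree `k`.
    have hlow : ∀ r : ℂ[X], r ∈ degreeLT ℂ (k + 1) → r.coeff k = 0 → r ∈ degreeLT ℂ k := by
      intro r hr h0
      rw [mem_degreeLT, degree_lt_iff_coeff_zero] at hr ⊢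
      intro m hm
      rcases hm.eq_or_lt with rfl | hm
      · exact h0
      · exact hr m hm
    have hcomb : q.coeff k • φ - p.coeff k • ψ = 0 := by
      have e : q.coeff k • φ - p.coeff k • ψ
          = aeval (coord 0 0 : C(CP n, ℂ)) (q.coeff k • p - p.coeff k • q) := by
        rw [map_sub, map_smul, map_smul, ← hφp, ← hψq]
      have hmem : q.coeff k • φ - p.coeff k • ψ ∈ harmonic n k :=
        sub_mem (Submodule.smul_mem _ _ (hle hφ)) (Submodule.smul_mem _ _ (hMle hψ))
      rw [e] at hmem ⊢
      refine eq_zero_of_mem_harmonic_of_degree_lt (hlow _ (sub_mem (Submodule.smul_mem _ _ hp)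
        (Submodule.smul_mem _ _ hq)) ?_) hmem
      simp [mul_comm]
    have hq0 : q.coeff k = 0 := by
      by_contra hq0
      have h1 : inner ℂ (toL2 n φ) (toL2 n (q.coeff k • φ)) = 0 := by
        rw [sub_eq_zero.1 hcomb, map_smul, inner_smul_right, hψ.2 φ hφ, mul_zero]
      rw [map_smul, inner_smul_right, mul_eq_zero] at h1
      exact hφ0 (eq_zero_of_inner_self (h1.resolve_left hq0))
    apply hψ0
    have hmem := hMle hψ
    rw [hψq] at hmem ⊢
    exact eq_zero_of_mem_harmonic_of_degree_lt (hlow q hq hq0) hmem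
  refine le_antisymm hle fun f hf => ?_
  obtain ⟨h, hh, ho⟩ := exists_mem_inner_sub_eq_zero N f
  have hfM : f - h ∈ M := ⟨sub_mem hf (hle hh), ho⟩
  rw [hMbot, Submodule.mem_bot, sub_eq_zero] at hfM
  rwa [hfM]

end

/-! ### Weights of one-parameter subgroups of the torus -/

/-- The one-parameter subgroup `τ ↦ diag(τ^(-w₁), …, τ^(-wₙ))`. With this sign the coordinate
function `z_k z̄_l` has weight `w_k - w_l`. -/
def oneParam (w : Fin n → ℤ) (τ : Circle) : U n := torusElt fun k => τ ^ (-w k)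

/-- The functions of weight `d` for the one-parameter subgroup of `w`. -/
def weightSpace (w : Fin n → ℤ) (d : ℤ) : Submodule ℂ C(CP n, ℂ) where
  carrier := {f | ∀ τ : Circle, act (oneParam w τ) f = (τ : ℂ) ^ d • f}
  add_mem' := by
    intro f g hf hg τ
    rw [map_add, hf, hg, smul_add]
  zero_mem' := by simp
  smul_mem' := by
    intro c f hf τ
    rw [map_smul, hf, smul_comm]

theorem mul_mem_weightSpace {w : Fin n → ℤ} {d e : ℤ} {f g : C(CP n, ℂ)}
    (hf : f ∈ weightSpace w d) (hg : g ∈ weightSpace w e) : f * g ∈ weightSpace w (d + e) := by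
  intro τ
  rw [map_mul, hf, hg, smul_mul_smul_comm, ← zpow_add₀ τ.coe_ne_zero]

theorem one_mem_weightSpace (w : Fin n → ℤ) : 1 ∈ weightSpace w 0 := by
  intro τ
  simp

theorem pow_mem_weightSpace {w : Fin n → ℤ} {d : ℤ} {f : C(CP n, ℂ)}
    (hf : f ∈ weightSpace w d) (k : ℕ) : f ^ k ∈ weightSpace w (k * d) := by
  induction k with
  | zero => simpa using one_mem_weightSpace w
  | succ k ih =>
    have h := mul_mem_weightSpace ih hf
    rwa [← pow_succ, show (k : ℤ) * d + d = ((k + 1 : ℕ) : ℤ) * d by push_cast; ring] at h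

theorem exists_circle_zpow_ne_one {d : ℤ} (hd : d ≠ 0) : ∃ τ : Circle, (τ : ℂ) ^ d ≠ 1 := by
  refine ⟨Circle.exp (Real.pi / d), ?_⟩
  have hd' : (d : ℂ) ≠ 0 := by exact_mod_cast hd
  rw [Circle.coe_exp, ← Complex.exp_int_mul]
  have : (d : ℂ) * (((Real.pi / d : ℝ) : ℂ) * Complex.I) = Real.pi * Complex.I := by
    push_cast
    field_simp
  rw [this, Complex.exp_pi_mul_I]
  norm_num

/-- The span of the functions of weight at most `d`. -/
def weightLE (w : Fin n → ℤ) (d : ℤ) : Submodule ℂ C(CP n, ℂ) :=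
  Submodule.span ℂ {f | ∃ e ≤ d, f ∈ weightSpace w e}

theorem mem_weightLE {w : Fin n → ℤ} {d e : ℤ} (h : e ≤ d) {f : C(CP n, ℂ)}
    (hf : f ∈ weightSpace w e) : f ∈ weightLE w d := Submodule.subset_span ⟨e, h, hf⟩

theorem weightLE_mono {w : Fin n → ℤ} {d e : ℤ} (h : e ≤ d) : weightLE w e ≤ weightLE w d :=
  Submodule.span_mono fun _ ⟨c, hc, hf⟩ => ⟨c, hc.trans h, hf⟩

theorem mul_mem_weightLE {w : Fin n → ℤ} {d e : ℤ} {f g : C(CP n, ℂ)}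
    (hf : f ∈ weightLE w d) (hg : g ∈ weightLE w e) : f * g ∈ weightLE w (d + e) := by
  have h : weightLE w d * weightLE w e ≤ weightLE w (d + e) := by
    rw [weightLE, weightLE, Submodule.span_mul_span, Submodule.span_le]
    rintro _ ⟨f, ⟨a, ha, hf⟩, g, ⟨b, hb, hg⟩, rfl⟩
    exact mem_weightLE (add_le_add ha hb) (mul_mem_weightSpace hf hg)
  exact h (Submodule.mul_mem_mul hf hg)

/-- The cocharacter `eᵢ - eⱼ`. -/
def root (i j : Fin n) (k : Fin n) : ℤ := (if k = i then 1 else 0) - if k = j then 1 else 0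

theorem root_sub_root_le {i j : Fin n} (k l : Fin n) : root i j k - root i j l ≤ 2 := by
  unfold root
  split_ifs <;> omega

theorem root_sub_root_le_one {i j : Fin n} {k l : Fin n} (h : (k, l) ≠ (i, j)) :
    root i j k - root i j l ≤ 1 := by
  rw [Ne, Prod.mk.injEq] at h
  unfold root
  split_ifs <;> omega

variable [NeZero n]

theorem act_torusElt_coord (t : Fin n → Circle) (i j : Fin n) :
    act (torusElt t) (coord i j) = ((t i : ℂ)⁻¹ * t j) • coord i j := by
  have hdiag : ∀ a b : Fin n, (torusElt t).1 a b = if a = b then (t a : ℂ) else 0 := fun a b =>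
    Matrix.diagonal_apply _ a b
  rw [act_coord, Finset.sum_eq_single i, Finset.sum_eq_single j]
  · rw [hdiag, hdiag, if_pos rfl, if_pos rfl, ← Circle.coe_inv_eq_conj, Circle.coe_inv]
  · intro b _ hb
    rw [hdiag b j, if_neg hb, mul_zero, zero_smul]
  · simp
  · intro b _ hb
    refine Finset.sum_eq_zero fun l _ => ?_
    rw [hdiag b i, if_neg hb, map_zero, zero_mul, zero_smul]
  · simp

theorem coord_mem_weightSpace (w : Fin n → ℤ) (i j : Fin n) :
    coord i j ∈ weightSpace w (w i - w j) := by
  intro τ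
  have h0 : (τ : ℂ) ≠ 0 := τ.coe_ne_zero
  rw [oneParam, act_torusElt_coord]
  simp only [zpow_neg, Circle.coe_inv, Circle.coe_zpow, inv_inv]
  rw [zpow_sub₀ h0, div_eq_mul_inv]

theorem inner_eq_zero_of_weight_ne {w : Fin n → ℤ} {d e : ℤ} (hde : d ≠ e) {f g : C(CP n, ℂ)}
    (hf : f ∈ weightSpace w d) (hg : g ∈ weightSpace w e) :
    inner ℂ (toL2 n f) (toL2 n g) = 0 := by
  obtain ⟨τ, hτ⟩ := exists_circle_zpow_ne_one (sub_ne_zero.2 hde.symm)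
  have h := inner_act_act (oneParam w τ) f g
  rw [hf τ, hg τ, map_smul, map_smul, inner_smul_left, inner_smul_right, map_zpow₀,
    ← Circle.coe_inv_eq_conj, Circle.coe_inv, inv_zpow, ← mul_assoc, ← zpow_neg,
    ← zpow_add₀ τ.coe_ne_zero, neg_add_eq_sub] at h
  by_contra h0
  exact hτ (mul_right_cancel₀ h0 (h.trans (one_mul _).symm))

theorem inner_eq_zero_of_mem_weightLE {w : Fin n → ℤ} {d e : ℤ} (h : e < d) {f g : C(CP n, ℂ)}
    (hf : f ∈ weightSpace w d) (hg : g ∈ weightLE w e) : inner ℂ (toL2 n f) (toL2 n g) = 0 := by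
  induction hg using Submodule.span_induction with
  | mem x hx =>
    obtain ⟨c, hc, hx⟩ := hx
    exact inner_eq_zero_of_weight_ne (hc.trans_lt h).ne' hf hx
  | zero => simp
  | add x y _ _ hx hy => rw [map_add, inner_add_right, hx, hy, add_zero]
  | smul a x _ hx => rw [map_smul, inner_smul_right, hx, mul_zero]

theorem linForms_pow_le_weightLE {w : Fin n → ℤ} {c : ℤ} (h : ∀ i j, w i - w j ≤ c) (k : ℕ) :
    linForms n ^ k ≤ weightLE w (k * c) := by
  have h1 : linForms n ≤ weightLE w c := by
    rw [linForms, Submodule.span_le]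
    rintro _ ⟨p, rfl⟩
    exact mem_weightLE (h _ _) (coord_mem_weightSpace w p.1 p.2)
  intro f hf
  induction hf using Submodule.pow_induction_on_left' with
  | algebraMap r =>
    rw [Algebra.algebraMap_eq_smul_one]
    exact Submodule.smul_mem _ _ (mem_weightLE (by simp) (one_mem_weightSpace w))
  | add x y i _ _ hx hy => exact add_mem hx hy
  | mem_mul m hm i x _ hx =>
    have := mul_mem_weightLE (h1 hm) hx
    convert this using 2
    push_cast
    ring

theorem coord_mem_weightSpace_root {i j : Fin n} (hij : i ≠ j) :
    coord i j ∈ weightSpace (root i j) 2 := by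
  have := coord_mem_weightSpace (root i j) i j
  simpa [root, hij, hij.symm] using this

theorem coord_pow_ne_zero {i j : Fin n} (hij : i ≠ j) (k : ℕ) :
    (coord i j : C(CP n, ℂ)) ^ k ≠ 0 := by
  -- A unit vector with nonzero entries in positions `i` and `j`.
  obtain ⟨x, hx⟩ := exists_point (fun l : Fin n => if l = i then (3 / 5 : ℂ) else
    if l = j then 4 / 5 else 0) (by
      rw [← Finset.add_sum_erase _ _ (Finset.mem_univ i),
        Finset.sum_eq_single_of_mem j (Finset.mem_erase.2 ⟨hij.symm, Finset.mem_univ j⟩)]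
      · simp [hij.symm, map_ofNat]; norm_num
      · intro b hb hbj
        simp [(Finset.mem_erase.1 hb).1, hbj])
  intro h
  have h1 := congrArg (fun f : C(CP n, ℂ) => f x) h
  simp [hx, hij.symm] at h1

/-- For `i ≠ j` the function `(zᵢ z̄ⱼ)ᵏ` is harmonic: its weight is too large for it to occur in
smaller degree. -/
theorem coord_pow_mem_harmonic {i j : Fin n} (hij : i ≠ j) (k : ℕ) :
    (coord i j : C(CP n, ℂ)) ^ k ∈ harmonic n k := by
  refine ⟨Submodule.pow_mem_pow _ (coord_mem i j) k, fun l hl h hh => ?_⟩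
  rw [inner_eq_zero_symm]
  refine inner_eq_zero_of_mem_weightLE ?_ (pow_mem_weightSpace (coord_mem_weightSpace_root hij) k)
    (linForms_pow_le_weightLE root_sub_root_le l hh)
  have : (l : ℤ) < k := by exact_mod_cast hl
  linarith

theorem weight_le_of_mem_pow {i j : Fin n} {k : ℕ} {d : ℤ} {f : C(CP n, ℂ)}
    (hf : f ∈ linForms n ^ k) (hf0 : f ≠ 0) (hw : f ∈ weightSpace (root i j) d) : d ≤ k * 2 := by
  by_contra! h
  exact hf0 (eq_zero_of_inner_self (inner_eq_zero_of_mem_weightLE h hw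
    (linForms_pow_le_weightLE root_sub_root_le k hf)))

end

/-! ### Representations in the discrete spectrum -/

theorem IsUnitaryRep.inner_map_left {G V : Type*} [Group G] [TopologicalSpace G]
    [NormedAddCommGroup V] [InnerProductSpace ℂ V] {π : ContRepresentation ℂ G V}
    (hπ : IsUnitaryRep π) (g : G) (u v : V) :
    inner ℂ (π g u) v = inner ℂ u (π g⁻¹ v) := by
  let φ : V →ₗᵢ[ℂ] V := ⟨(π g).toLinearMap, hπ.norm_map g⟩
  have h : π g (π g⁻¹ v) = v := by
    have : (π g * π g⁻¹) v = v := by rw [← map_mul, mul_inv_cancel, map_one]; rfl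
    exact this
  conv_lhs => rw [← h]
  exact φ.inner_map_map u _

section

variable {n : ℕ} [NeZero n] {V : Type*} [NormedAddCommGroup V] [InnerProductSpace ℂ V]
  {π : ContRepresentation ℂ (U n) V}

/-- `L` restricts to an equivariant isomorphism of the harmonic space of degree `k` onto `π`. Only
the restriction of `L` to the harmonic space matters. -/
structure IsModel (π : ContRepresentation ℂ (U n) V) (k : ℕ) (L : C(CP n, ℂ) →ₗ[ℂ] V) :
    Prop where
  map_act : ∀ g, ∀ f ∈ harmonic n k, L (act g f) = π g (L f)
  eq_zero : ∀ f ∈ harmonic n k, L f = 0 → f = 0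
  surj : ∀ v, ∃ f ∈ harmonic n k, L f = v

theorem isModel_of_ne_zero {j : Fin n} (hj : j ≠ 0) (hπ : IsIrreducibleRep π) {k : ℕ}
    {L : C(CP n, ℂ) →ₗ[ℂ] V} (hL : ∀ g, ∀ f ∈ harmonic n k, L (act g f) = π g (L f))
    (h0 : ∃ f ∈ harmonic n k, L f ≠ 0) : IsModel π k L := by
  obtain ⟨f₀, hf₀, hf₀'⟩ := h0
  refine ⟨hL, fun f hf hLf => ?_, fun v => ?_⟩
  · rcases eq_bot_or_eq_harmonic hj (N := harmonic n k ⊓ LinearMap.ker L) inf_le_left (by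
      rintro g f ⟨hf, hf'⟩
      refine ⟨act_mem_harmonic g hf, ?_⟩
      change L (act g f) = 0
      rw [hL g f hf, LinearMap.mem_ker.1 hf', map_zero]) with h | h
    · have : f ∈ harmonic n k ⊓ LinearMap.ker L := ⟨hf, hLf⟩
      rwa [h] at this
    · rw [← h] at hf₀
      exact absurd hf₀.2 hf₀'
  · have hfin : FiniteDimensional ℂ ((harmonic n k).map L) := inferInstance
    rcases hπ.eq_bot_or_top ((harmonic n k).map L) (Submodule.closed_of_finiteDimensional _) (by
      rintro g _ ⟨f, hf, rfl⟩
      exact ⟨act g f, act_mem_harmonic g hf, hL g f hf⟩) with h | h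
    · have : L f₀ ∈ (harmonic n k).map L := Submodule.mem_map_of_mem hf₀
      rw [h] at this
      exact absurd this hf₀'
    · have : v ∈ (harmonic n k).map L := by rw [h]; trivial
      exact this

theorem IsModel.finiteDimensional {k : ℕ} {L : C(CP n, ℂ) →ₗ[ℂ] V} (h : IsModel π k L) :
    FiniteDimensional ℂ V :=
  Module.Finite.of_surjective (L.domRestrict (harmonic n k)) fun v => by
    obtain ⟨f, hf, rfl⟩ := h.surj v
    exact ⟨⟨f, hf⟩, rfl⟩

/-- Schur's lemma for maps out of a harmonic space. -/
theorem IsModel.exists_smul {j : Fin n} (hj : j ≠ 0) {k : ℕ} {L L' : C(CP n, ℂ) →ₗ[ℂ] V}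
    (h : IsModel π k L) (hL' : ∀ g, ∀ f ∈ harmonic n k, L' (act g f) = π g (L' f)) :
    ∃ c : ℂ, ∀ f ∈ harmonic n k, L' f = c • L f := by
  have := h.finiteDimensional
  have : Nontrivial V := ⟨L (coord j 0 ^ k), 0, fun h0 =>
    coord_pow_ne_zero hj k (h.eq_zero _ (coord_pow_mem_harmonic hj k) h0)⟩
  let e : harmonic n k ≃ₗ[ℂ] V := LinearEquiv.ofBijective (L.domRestrict (harmonic n k))
    ⟨(injective_iff_map_eq_zero _).2 fun f hf => Subtype.ext (h.eq_zero f f.2 hf), fun v => by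
      obtain ⟨f, hf, rfl⟩ := h.surj v
      exact ⟨⟨f, hf⟩, rfl⟩⟩
  obtain ⟨c, hc⟩ := Module.End.exists_eigenvalue
    (L'.domRestrict (harmonic n k) ∘ₗ e.symm.toLinearMap)
  obtain ⟨v, hv⟩ := hc.exists_hasEigenvector
  refine ⟨c, ?_⟩
  have hv' : L' (e.symm v) = c • L (e.symm v) :=
    hv.apply_eq_smul.trans (congrArg (c • ·) (e.apply_symm_apply v).symm)
  rcases eq_bot_or_eq_harmonic hj (N := harmonic n k ⊓ LinearMap.ker (L' - c • L)) inf_le_left (by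
      rintro g f ⟨hf, hf'⟩
      refine ⟨act_mem_harmonic g hf, ?_⟩
      have h1 : L' f - c • L f = 0 := hf'
      change L' (act g f) - c • L (act g f) = 0
      rw [hL' g f hf, h.map_act g f hf, ← map_smul, ← map_sub, h1, map_zero]) with h1 | h1
  · have hmem : (e.symm v : C(CP n, ℂ)) ∈ harmonic n k ⊓ LinearMap.ker (L' - c • L) :=
      ⟨(e.symm v).2, sub_eq_zero.2 hv'⟩
    rw [h1, Submodule.mem_bot] at hmem
    exact absurd (e.symm.map_eq_zero_iff.1 (Subtype.ext hmem)) hv.2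
  · intro f hf
    rw [← h1] at hf
    exact sub_eq_zero.1 hf.2

theorem apply_zero_nonneg_of_mem_positiveRootCone {μ : Fin n → ℤ} (h : μ ∈ positiveRootCone n) :
    0 ≤ μ 0 := by
  induction h using AddSubmonoid.closure_induction with
  | mem x hx =>
    obtain ⟨i, j, hij, rfl⟩ := hx
    have hj : j ≠ 0 := (Fin.zero_le i |>.trans_lt hij).ne'
    rw [Pi.sub_apply, Pi.single_eq_of_ne hj.symm, sub_zero, Pi.single_apply]
    split_ifs <;> norm_num
  | zero => simp
  | add x y _ _ hx hy => exact add_nonneg hx hy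

theorem prod_zpow_sphericalWeight {j : Fin n} (hj : j ≠ 0) (hjn : (j : ℕ) + 1 = n) (a : ℤ)
    (t : Fin n → Circle) :
    ∏ i, (t i : ℂ) ^ sphericalWeight n a i = (t 0 : ℂ) ^ a * (t j : ℂ) ^ (-a) := by
  have hj0 : (j : ℕ) ≠ 0 := fun h => hj (Fin.ext (by simpa using h))
  rw [Finset.prod_eq_mul 0 j hj.symm]
  · simp [sphericalWeight, hj0, hjn]
  · rintro i - ⟨hi, hij⟩
    have h1 : (i : ℕ) ≠ 0 := fun h => hi (Fin.ext (by simpa using h))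
    have h2 : (i : ℕ) + 1 ≠ n := fun h => hij (Fin.ext (by omega))
    simp [sphericalWeight, h1, h2]
  · simp
  · simp

/-- The harmonic space of degree `k` has highest weight `(k, 0, …, 0, -k)`. -/
theorem IsModel.eq_of_isHighestWeight {j : Fin n} (hj : j ≠ 0) (hjn : (j : ℕ) + 1 = n) {k : ℕ}
    {L : C(CP n, ℂ) →ₗ[ℂ] V} (h : IsModel π k L) {a : ℤ}
    (ha : IsHighestWeight π (sphericalWeight n a)) : a = k := by
  obtain ⟨⟨v, hv0, hv⟩, hmax⟩ := ha
  apply le_antisymm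
  · -- A weight vector of `π` comes from a function of weight `2a` and of degree `k`.
    obtain ⟨f, hf, rfl⟩ := h.surj v
    have hf0 : f ≠ 0 := by
      rintro rfl
      exact hv0 (map_zero L)
    have hw : f ∈ weightSpace (root j 0) (a * 2) := by
      intro τ
      have h1 := hv fun i => τ ^ (-root j 0 i)
      have h2 : ∏ i, ((τ ^ (-root j 0 i) : Circle) : ℂ) ^ sphericalWeight n a i
          = (τ : ℂ) ^ (a * 2) := by
        rw [prod_zpow_sphericalWeight hj hjn a fun i => τ ^ (-root j 0 i)]
        simp only [root, hj, hj.symm, if_true, if_false, Circle.coe_zpow]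
        rw [← zpow_mul, ← zpow_mul, ← zpow_add₀ τ.coe_ne_zero]
        congr 1
        ring
      rw [h2, ← h.map_act _ f hf, ← map_smul, ← sub_eq_zero, ← map_sub] at h1
      exact sub_eq_zero.1 (h.eq_zero _ (sub_mem (act_mem_harmonic _ hf)
        (Submodule.smul_mem _ _ hf)) h1)
    have := weight_le_of_mem_pow (harmonic_le_pow k hf) hf0 hw
    linarith
  · -- The image of `(zⱼ z̄₁)ᵏ` is a weight vector of weight `(k, 0, …, 0, -k)`.
    have hmem := coord_pow_mem_harmonic hj k
    have hk : IsWeight π (sphericalWeight n k) := by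
      refine ⟨L (coord j 0 ^ k), fun h0 => coord_pow_ne_zero hj k (h.eq_zero _ hmem h0),
        fun t => ?_⟩
      rw [← h.map_act _ _ hmem, map_pow, act_torusElt_coord, smul_pow, map_smul,
        prod_zpow_sphericalWeight hj hjn, mul_pow, zpow_neg, zpow_natCast, zpow_natCast, inv_pow,
        mul_comm]
    have := apply_zero_nonneg_of_mem_positiveRootCone (hmax _ hk)
    simpa [sphericalWeight] using this

/-- A representation in the discrete spectrum is isomorphic to a harmonic space: the adjoint of a
nonzero intertwiner into `L²`, restricted to continuous functions, is nonzero on the functions of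
some smallest degree `k`, hence on the harmonic space of degree `k`, which is irreducible. -/
theorem IsInDiscreteSpectrum.exists_isModel [CompleteSpace V] {j : Fin n} (hj : j ≠ 0)
    (hπ : IsInDiscreteSpectrum π) :
    ∃ (k : ℕ) (L : C(CP n, ℂ) →ₗ[ℂ] V), (∀ g f, L (act g f) = π g (L f)) ∧
      (∀ i < k, ∀ f ∈ linForms n ^ i, L f = 0) ∧ IsModel π k L := by
  obtain ⟨T, hT0, hT⟩ := hπ.occurs
  let L : C(CP n, ℂ) →L[ℂ] V := T.adjoint ∘L toL2 n
  have hL : ∀ g f, L (act g f) = π g (L f) := by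
    intro g f
    refine ext_inner_right ℂ fun v => ?_
    rw [hπ.unitary.inner_map_left]
    change inner ℂ (T.adjoint (toL2 n (act g f))) v = inner ℂ (T.adjoint (toL2 n f)) (π g⁻¹ v)
    rw [ContinuousLinearMap.adjoint_inner_left, ContinuousLinearMap.adjoint_inner_left,
      L2.inner_def, L2.inner_def]
    have h1 : ∀ f : C(CP n, ℂ), toL2 n f =ᵐ[invMeasure n] f := fun f =>
      ContinuousMap.coeFn_toLp (invMeasure n) f
    have e1 : ∫ x, inner ℂ (toL2 n (act g f) x) (T v x) ∂invMeasure n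
        = ∫ x, inner ℂ (f (g⁻¹ • x)) (T v x) ∂invMeasure n := by
      refine integral_congr_ae ?_
      filter_upwards [h1 (act g f)] with x hx
      rw [hx, act_apply]
    have e2 : ∫ x, inner ℂ (toL2 n f x) (T (π g⁻¹ v) x) ∂invMeasure n
        = ∫ x, inner ℂ (f x) (T v (g • x)) ∂invMeasure n := by
      refine integral_congr_ae ?_
      filter_upwards [h1 f, hT g⁻¹ v] with x hx hx'
      rw [hx, hx', inv_inv]
    rw [e1, e2, ← (invMeasure_measurePreserving n g).integral_comp
      (Homeomorph.smul g).measurableEmbedding]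
    simp only [inv_smul_smul]
  have hne : ∃ k, ∃ f ∈ linForms n ^ k, L f ≠ 0 := by
    by_contra! hc
    have h0 := eq_zero_of_forall_pow L hc
    have hd : DenseRange (toL2 n) := ContinuousMap.toLp_denseRange ℂ (invMeasure n) ℂ (by simp)
    have hadj : T.adjoint = 0 := by
      refine ContinuousLinearMap.ext fun u => ?_
      exact congrFun (hd.equalizer T.adjoint.continuous continuous_const (funext h0)) u
    apply hT0
    rw [← ContinuousLinearMap.adjoint_adjoint T, hadj, map_zero]
  classical
  let k := Nat.find hne
  have hlow : ∀ i < k, ∀ f ∈ linForms n ^ i, L f = 0 := by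
    intro i hi f hf
    by_contra h0
    exact Nat.find_min hne hi ⟨f, hf, h0⟩
  obtain ⟨f, hf, hf0⟩ := Nat.find_spec hne
  obtain ⟨h, hh, hfh⟩ := exists_harmonic_add hf
  refine ⟨k, L.toLinearMap, hL, hlow, isModel_of_ne_zero hj hπ.irreducible (fun g f _ => hL g f)
    ⟨h, hh, fun h0 => hf0 ?_⟩⟩
  have hz : L (f - h) = 0 := by
    rcases hfh with h1 | ⟨i, hi, h1⟩
    · rw [h1, map_zero]
    · exact hlow i hi _ h1
  rw [map_sub, sub_eq_zero] at hz
  exact hz.trans h0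

end

/-! ### Restriction to a hyperplane -/

section

variable {m : ℕ}

theorem embed_castSucc_castSucc (A : U m) (i j : Fin m) :
    (embed m A).1 i.castSucc j.castSucc = A.1 i j := by
  change Matrix.fromBlocks A.1 0 0 1 (finSumFinEquiv.symm (Fin.castAdd 1 i))
    (finSumFinEquiv.symm (Fin.castAdd 1 j)) = _
  simp

theorem embed_castSucc_last (A : U m) (i : Fin m) :
    (embed m A).1 i.castSucc (Fin.last m) = 0 := by
  change Matrix.fromBlocks A.1 0 0 1 (finSumFinEquiv.symm (Fin.castAdd 1 i))
    (finSumFinEquiv.symm (Fin.last m)) = _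
  simp

theorem embed_last_castSucc (A : U m) (i : Fin m) :
    (embed m A).1 (Fin.last m) i.castSucc = 0 := by
  change Matrix.fromBlocks A.1 0 0 1 (finSumFinEquiv.symm (Fin.last m))
    (finSumFinEquiv.symm (Fin.castAdd 1 i)) = _
  simp

theorem embed_last_last (A : U m) : (embed m A).1 (Fin.last m) (Fin.last m) = 1 := by
  change Matrix.fromBlocks A.1 0 0 1 (finSumFinEquiv.symm (Fin.last m))
    (finSumFinEquiv.symm (Fin.last m)) = _
  simp

theorem continuous_embed : Continuous (embed m) := by
  refine continuous_induced_rng.2 (continuous_matrix fun i j => ?_)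
  change Continuous fun A : U m => (embed m A).1 i j
  induction i using Fin.lastCases with
  | last =>
    induction j using Fin.lastCases with
    | last => simpa only [embed_last_last] using continuous_const
    | cast j => simpa only [embed_last_castSucc] using continuous_const
  | cast i =>
    induction j using Fin.lastCases with
    | last => simpa only [embed_castSucc_last] using continuous_const
    | cast j => simpa only [embed_castSucc_castSucc] using continuous_entry i j

variable (m) in
/-- The span of the coordinate functions `zᵢ z̄ⱼ` which do not involve the last coordinate. -/
def cornerForms : Submodule ℂ C(CP (m + 1), ℂ) :=
  Submodule.span ℂ (Set.range fun p : Fin m × Fin m => coord p.1.castSucc p.2.castSucc)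

theorem coord_mem_cornerForms (i j : Fin m) : coord i.castSucc j.castSucc ∈ cornerForms m :=
  Submodule.subset_span ⟨(i, j), rfl⟩

theorem cornerForms_le : cornerForms m ≤ linForms (m + 1) :=
  Submodule.span_le.2 (by rintro _ ⟨p, rfl⟩; exact coord_mem _ _)

theorem act_embed_coord_last (A : U m) :
    act (embed m A) (coord (Fin.last m) (Fin.last m)) = coord (Fin.last m) (Fin.last m) := by
  rw [act_coord, Fin.sum_univ_castSucc, Fin.sum_univ_castSucc]
  simp [embed_castSucc_last, embed_last_last]

theorem cornerForms_pow_le (a : ℕ) : cornerForms m ^ a ≤ linForms (m + 1) ^ a :=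
  pow_le_pow_left' (M := Submodule ℂ C(CP (m + 1), ℂ)) cornerForms_le a

theorem act_embed_mem_cornerForms_pow (A : U m) {a : ℕ} {f : C(CP (m + 1), ℂ)}
    (hf : f ∈ cornerForms m ^ a) : act (embed m A) f ∈ cornerForms m ^ a := by
  have h1 : (cornerForms m).map (act (embed m A)).toLinearMap ≤ cornerForms m := by
    rw [cornerForms, Submodule.map_span_le]
    rintro _ ⟨p, rfl⟩
    change act (embed m A) (coord _ _) ∈ _
    rw [act_coord, Fin.sum_univ_castSucc]
    refine add_mem (Submodule.sum_mem _ fun k _ => ?_) (Submodule.sum_mem _ fun l _ => ?_)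
    · rw [Fin.sum_univ_castSucc, embed_last_castSucc, mul_zero, zero_smul, add_zero]
      exact Submodule.sum_mem _ fun l _ => Submodule.smul_mem _ _ (coord_mem_cornerForms k l)
    · rw [embed_last_castSucc, map_zero, zero_mul, zero_smul]
      exact zero_mem _
  have h : (cornerForms m ^ a).map (act (embed m A)).toLinearMap ≤ cornerForms m ^ a := by
    rw [Submodule.map_pow]
    exact pow_le_pow_left' h1 a
  exact h (Submodule.mem_map_of_mem hf)

variable [NeZero m]

theorem embed_mem_blockSubgroup {A : U m} (hA : A ∈ blockSubgroup m) :
    embed m A ∈ blockSubgroup (m + 1) := by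
  refine mem_blockSubgroup_iff.2 fun j hj => ?_
  rw [← Fin.castSucc_zero'] at hj ⊢
  induction j using Fin.lastCases with
  | last => exact ⟨embed_castSucc_last _ _, embed_last_castSucc _ _⟩
  | cast j =>
    rw [embed_castSucc_castSucc, embed_castSucc_castSucc]
    exact mem_blockSubgroup_iff.1 hA j fun h => hj (by rw [h])

/-- The inclusion `[z] ↦ [z, 0]` of projective spaces. -/
def hyperplane : C(CP m, CP (m + 1)) where
  toFun := Quotient.map (embed m) (by
    intro A B h
    refine QuotientGroup.leftRel_apply.2 ?_
    rw [← map_inv, ← map_mul]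
    exact embed_mem_blockSubgroup (QuotientGroup.leftRel_apply.1 h))
  continuous_toFun := continuous_embed.quotient_map' _

theorem hyperplane_smul (A : U m) (y : CP m) : hyperplane (A • y) = embed m A • hyperplane y := by
  induction y using QuotientGroup.induction_on with | _ B
  change QuotientGroup.mk (embed m (A * B)) = QuotientGroup.mk (embed m A * embed m B)
  rw [map_mul]

/-- Restriction of functions to the hyperplane. -/
def res : C(CP (m + 1), ℂ) →ₐ[ℂ] C(CP m, ℂ) := ContinuousMap.compRightAlgHom ℂ ℂ hyperplane

theorem res_apply (f : C(CP (m + 1), ℂ)) (y : CP m) : res f y = f (hyperplane y) := rfl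

theorem res_act (A : U m) (f : C(CP (m + 1), ℂ)) : res (act (embed m A) f) = act A (res f) := by
  ext y
  rw [res_apply, act_apply, act_apply, res_apply, hyperplane_smul, map_inv]

theorem res_coord (i j : Fin m) : res (coord i.castSucc j.castSucc) = coord i j := by
  ext y
  induction y using QuotientGroup.induction_on with | _ A
  change (embed m A).1 i.castSucc 0 * conj ((embed m A).1 j.castSucc 0) = A.1 i 0 * conj (A.1 j 0)
  rw [← Fin.castSucc_zero', embed_castSucc_castSucc, embed_castSucc_castSucc]

theorem map_res_cornerForms_pow (a : ℕ) :
    (cornerForms m ^ a).map (res (m := m)).toLinearMap = linForms m ^ a := by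
  rw [Submodule.map_pow]
  congr 1
  rw [cornerForms, Submodule.map_span, linForms, ← Set.range_comp]
  congr 2
  funext p
  exact res_coord p.1 p.2

/-- The vector of the first `m` coordinates is a multiple of a unit vector. -/
theorem exists_corner_eq_smul (x : CP (m + 1)) :
    ∃ (c : ℂ) (y : CP m), ∀ i j : Fin m, coord i.castSucc j.castSucc x = c * coord i j y := by
  obtain ⟨z, -, hz⟩ := exists_rep x
  let s : ℝ := Real.sqrt (∑ k : Fin m, ‖z k.castSucc‖ ^ 2)
  have hs : s ^ 2 = ∑ k : Fin m, ‖z k.castSucc‖ ^ 2 :=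
    Real.sq_sqrt (Finset.sum_nonneg fun k _ => by positivity)
  by_cases h0 : s = 0
  · refine ⟨0, QuotientGroup.mk 1, fun i j => ?_⟩
    rw [h0, zero_pow two_ne_zero] at hs
    have := (Finset.sum_eq_zero_iff_of_nonneg fun k _ => by positivity).1 hs.symm i
      (Finset.mem_univ i)
    have hi : z i.castSucc = 0 := by simpa using this
    rw [hz, hi, zero_mul, zero_mul]
  · have h0' : (s : ℂ) ≠ 0 := by exact_mod_cast h0
    obtain ⟨y, hy⟩ := exists_point (fun k : Fin m => z k.castSucc / s) (by
      have hs' : (s : ℂ) ^ 2 = ∑ k : Fin m, conj (z k.castSucc) * z k.castSucc := by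
        rw [← Complex.ofReal_pow, hs]
        push_cast
        exact Finset.sum_congr rfl fun k _ => (Complex.conj_mul' _).symm
      have : ∀ k : Fin m, conj (z k.castSucc / s) * (z k.castSucc / s)
          = conj (z k.castSucc) * z k.castSucc / (s : ℂ) ^ 2 := by
        intro k
        rw [map_div₀, Complex.conj_ofReal]
        field_simp
      rw [Finset.sum_congr rfl fun k _ => this k, ← Finset.sum_div, ← hs']
      field_simp)
    refine ⟨(s : ℂ) ^ 2, y, fun i j => ?_⟩
    rw [hz, hy, map_div₀, Complex.conj_ofReal]
    field_simp

theorem apply_eq_pow_mul_res {x : CP (m + 1)} {c : ℂ} {y : CP m}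
    (h : ∀ i j : Fin m, coord i.castSucc j.castSucc x = c * coord i j y) {a : ℕ}
    {f : C(CP (m + 1), ℂ)} (hf : f ∈ cornerForms m ^ a) : f x = c ^ a * res f y := by
  have h1 : ∀ f ∈ cornerForms m, f x = c * res f y := by
    intro f hf
    rw [cornerForms] at hf
    induction hf using Submodule.span_induction with
    | mem f hf =>
      obtain ⟨p, rfl⟩ := hf
      simp only [res_coord]
      exact h p.1 p.2
    | zero => simp
    | add f g _ _ hf hg =>
      rw [map_add, ContinuousMap.add_apply, ContinuousMap.add_apply, hf, hg, mul_add]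
    | smul r f _ hf =>
      rw [map_smul, ContinuousMap.smul_apply, ContinuousMap.smul_apply, hf, smul_eq_mul,
        smul_eq_mul, mul_left_comm]
  induction hf using Submodule.pow_induction_on_left' with
  | algebraMap r => rw [AlgHom.commutes, pow_zero, one_mul]; rfl
  | add f g i _ _ hf hg =>
    rw [map_add, ContinuousMap.add_apply, ContinuousMap.add_apply, hf, hg, mul_add]
  | mem_mul f hf i g _ hg =>
    rw [map_mul, ContinuousMap.mul_apply, ContinuousMap.mul_apply, h1 f hf, hg, pow_succ]
    ring

theorem eq_zero_of_res_eq_zero {a : ℕ} {f : C(CP (m + 1), ℂ)} (hf : f ∈ cornerForms m ^ a)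
    (h0 : res f = 0) : f = 0 := by
  ext x
  obtain ⟨c, y, h⟩ := exists_corner_eq_smul x
  rw [apply_eq_pow_mul_res h hf, h0]
  simp

variable (m) in
/-- A homogeneous polynomial in the first `m` coordinates is determined by its restriction to the
unit sphere; the inverse of the restriction map extends functions of degree `a` on the hyperplane
to projective space. -/
theorem exists_extension (a : ℕ) : ∃ E : C(CP m, ℂ) →ₗ[ℂ] C(CP (m + 1), ℂ),
    ∀ F ∈ linForms m ^ a, E F ∈ cornerForms m ^ a ∧ res (E F) = F := by
  let r : ↥(cornerForms m ^ a) →ₗ[ℂ] ↥(linForms m ^ a) :=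
    (res (m := m)).toLinearMap.restrict fun f hf => by
      rw [← map_res_cornerForms_pow]
      exact Submodule.mem_map_of_mem hf
  have hr : Function.Bijective r := by
    refine ⟨(injective_iff_map_eq_zero _).2 fun f hf => Subtype.ext ?_, fun F => ?_⟩
    · exact eq_zero_of_res_eq_zero f.2 (congrArg Subtype.val hf)
    · obtain ⟨f, hf, hfF⟩ := (map_res_cornerForms_pow (m := m) a).ge F.2
      exact ⟨⟨f, hf⟩, Subtype.ext hfF⟩
  let e := LinearEquiv.ofBijective r hr
  obtain ⟨E, hE⟩ := LinearMap.exists_extend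
    ((cornerForms m ^ a).subtype ∘ₗ e.symm.toLinearMap)
  refine ⟨E, fun F hF => ?_⟩
  have h1 : E F = (e.symm ⟨F, hF⟩ : C(CP (m + 1), ℂ)) :=
    congrArg (fun φ : ↥(linForms m ^ a) →ₗ[ℂ] C(CP (m + 1), ℂ) => φ ⟨F, hF⟩) hE
  rw [h1]
  exact ⟨(e.symm ⟨F, hF⟩).2, congrArg Subtype.val (e.apply_symm_apply ⟨F, hF⟩)⟩

theorem extension_act {a : ℕ} {E : C(CP m, ℂ) →ₗ[ℂ] C(CP (m + 1), ℂ)}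
    (hE : ∀ F ∈ linForms m ^ a, E F ∈ cornerForms m ^ a ∧ res (E F) = F) (A : U m)
    {F : C(CP m, ℂ)} (hF : F ∈ linForms m ^ a) : E (act A F) = act (embed m A) (E F) := by
  rw [← sub_eq_zero]
  refine eq_zero_of_res_eq_zero (sub_mem (hE _ (act_mem_pow A hF)).1
    (act_embed_mem_cornerForms_pow A (hE F hF).1)) ?_
  rw [map_sub, (hE _ (act_mem_pow A hF)).2, res_act, (hE F hF).2, sub_self]

end

/-! ### The functions which see a representation of the smaller group -/

section

theorem mul_sup_pow_le {R A : Type*} [CommSemiring R] [CommSemiring A] [Algebra R A]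
    {P Q N : Submodule R A} {a : ℕ} (M : Submodule R A)
    (h : ∀ i j, i + j = a → M * P ^ i * Q ^ j ≤ N) : M * (P ⊔ Q) ^ a ≤ N := by
  induction a generalizing M with
  | zero => simpa using h 0 0 rfl
  | succ a ih =>
    rw [pow_succ', ← mul_assoc, Submodule.mul_sup, Submodule.sup_mul]
    refine sup_le (ih _ fun i j hij => ?_) (ih _ fun i j hij => ?_)
    · have := h (i + 1) j (by omega)
      rwa [pow_succ', ← mul_assoc] at this
    · have := h i (j + 1) (by omega)
      rw [pow_succ', ← mul_assoc] at this
      rwa [mul_right_comm M Q]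

theorem sup_pow_le {R A : Type*} [CommSemiring R] [CommSemiring A] [Algebra R A]
    {P Q N : Submodule R A} {a : ℕ} (h : ∀ i j, i + j = a → P ^ i * Q ^ j ≤ N) :
    (P ⊔ Q) ^ a ≤ N := by
  have := mul_sup_pow_le 1 (P := P) (Q := Q) (N := N) (a := a) (by simpa using h)
  simpa using this

/-- If `P Q ⊆ D²`, then the `a`-th power of `P + Q + D` is contained in `N` as soon as `N` contains
`Dᵃ` and the unbalanced products. -/
theorem sup_sup_pow_le {R A : Type*} [CommSemiring R] [CommSemiring A] [Algebra R A]
    {P Q D N : Submodule R A} {a : ℕ} (hPQ : P * Q ≤ D ^ 2) (hD : D ^ a ≤ N)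
    (h : ∀ i j k, i ≠ j → P ^ i * Q ^ j * D ^ k ≤ N) : (P ⊔ Q ⊔ D) ^ a ≤ N := by
  refine sup_pow_le fun i k hik => ?_
  rw [mul_comm]
  refine mul_sup_pow_le _ fun p q hpq => ?_
  rw [mul_assoc, mul_comm]
  by_cases hne : p = q
  · subst hne
    rw [← mul_pow]
    calc (P * Q) ^ p * D ^ k ≤ (D ^ 2) ^ p * D ^ k := by gcongr
      _ = D ^ a := by rw [← pow_mul, ← pow_add]; congr 1; omega
      _ ≤ N := hD
  · exact h p q k hne

theorem pow_le_weightSpace {n : ℕ} {w : Fin n → ℤ} {d : ℤ} {N : Submodule ℂ C(CP n, ℂ)}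
    (h : N ≤ weightSpace w d) (k : ℕ) : N ^ k ≤ weightSpace w (k * d) := by
  intro f hf
  induction hf using Submodule.pow_induction_on_left' with
  | algebraMap r =>
    rw [Algebra.algebraMap_eq_smul_one]
    refine Submodule.smul_mem _ _ ?_
    simpa using one_mem_weightSpace w
  | add x y i _ _ hx hy => exact add_mem hx hy
  | mem_mul f hf i x _ hx =>
    have := mul_mem_weightSpace (h hf) hx
    rwa [show d + (i : ℤ) * d = ((i + 1 : ℕ) : ℤ) * d by push_cast; ring] at this

variable {m : ℕ}

variable (m) in
/-- The cocharacter of the centre of `U(m) ⊂ U(m+1)`. -/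
def centre (i : Fin (m + 1)) : ℤ := if i = Fin.last m then 0 else 1

theorem centre_castSucc (i : Fin m) : centre m i.castSucc = 1 := if_neg (Fin.castSucc_lt_last i).ne

theorem centre_last : centre m (Fin.last m) = 0 := if_pos rfl

theorem embed_oneParam (τ : Circle) :
    embed m (oneParam (fun _ => 1) τ) = oneParam (centre m) τ := by
  refine Subtype.ext (Matrix.ext fun i j => ?_)
  have h : ∀ (n : ℕ) (t : Fin n → Circle) (a b : Fin n),
      (torusElt t).1 a b = if a = b then (t a : ℂ) else 0 := fun n t a b =>
    Matrix.diagonal_apply _ a b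
  rw [oneParam, oneParam, h]
  induction i using Fin.lastCases with
  | last =>
    induction j using Fin.lastCases with
    | last => simp [embed_last_last, centre_last]
    | cast j => simp [embed_last_castSucc, (Fin.castSucc_lt_last j).ne']
  | cast i =>
    induction j using Fin.lastCases with
    | last => simp [embed_castSucc_last, (Fin.castSucc_lt_last i).ne]
    | cast j => simp [embed_castSucc_castSucc, h, centre_castSucc]

/-- A linear map which kills the functions of degree less than `a`, the functions of nonzero weight
for the centre of `U(m)`, and the functions of degree `a` in the first `m` coordinates, kills all
functions of degree `a`. Indeed, the coordinate functions `zᵢ z̄ₘ₊₁` and `zₘ₊₁ z̄ⱼ` have weights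
`1` and `-1`, their products can be rewritten as `zᵢ z̄ⱼ |zₘ₊₁|²`, and
`|zₘ₊₁|² = 1 - |z₁|² - … - |zₘ|²`. -/
theorem eq_zero_of_corner {E : Type*} [AddCommGroup E] [Module ℂ E] {a : ℕ}
    {S : C(CP (m + 1), ℂ) →ₗ[ℂ] E} (hlow : ∀ i < a, ∀ f ∈ linForms (m + 1) ^ i, S f = 0)
    (hcentre : ∀ d ≠ 0, ∀ f ∈ weightSpace (centre m) d, S f = 0)
    (hcorner : ∀ f ∈ cornerForms m ^ a, S f = 0) {f : C(CP (m + 1), ℂ)}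
    (hf : f ∈ linForms (m + 1) ^ a) : S f = 0 := by
  let P : Submodule ℂ C(CP (m + 1), ℂ) :=
    Submodule.span ℂ (Set.range fun i : Fin m => coord i.castSucc (Fin.last m))
  let Q : Submodule ℂ C(CP (m + 1), ℂ) :=
    Submodule.span ℂ (Set.range fun j : Fin m => coord (Fin.last m) j.castSucc)
  let D : Submodule ℂ C(CP (m + 1), ℂ) := cornerForms m ⊔ ℂ ∙ coord (Fin.last m) (Fin.last m)
  have hall : linForms (m + 1) ≤ P ⊔ Q ⊔ D := by
    rw [linForms, Submodule.span_le]
    rintro _ ⟨⟨i, j⟩, rfl⟩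
    change coord i j ∈ P ⊔ Q ⊔ D
    induction i using Fin.lastCases with
    | last =>
      induction j using Fin.lastCases with
      | last => exact le_sup_right (a := P ⊔ Q) (le_sup_right (a := cornerForms m)
          (Submodule.mem_span_singleton_self _))
      | cast j => exact le_sup_left (a := P ⊔ Q) (le_sup_right (a := P)
          (Submodule.subset_span ⟨j, rfl⟩))
    | cast i =>
      induction j using Fin.lastCases with
      | last => exact le_sup_left (a := P ⊔ Q) (le_sup_left (a := P)
          (Submodule.subset_span ⟨i, rfl⟩))
      | cast j => exact le_sup_right (a := P ⊔ Q) (le_sup_left (a := cornerForms m)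
          (coord_mem_cornerForms i j))
  have hPQ : P * Q ≤ D ^ 2 := by
    rw [Submodule.span_mul_span, Submodule.span_le]
    rintro _ ⟨_, ⟨i, rfl⟩, _, ⟨j, rfl⟩, rfl⟩
    change coord _ _ * coord _ _ ∈ D ^ 2
    rw [coord_mul_coord, pow_two (M := Submodule ℂ C(CP (m + 1), ℂ))]
    exact Submodule.mul_mem_mul (le_sup_left (a := cornerForms m) (coord_mem_cornerForms i j))
      (le_sup_right (a := cornerForms m) (Submodule.mem_span_singleton_self _))
  have hD1 : D ≤ cornerForms m ⊔ 1 := by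
    refine sup_le le_sup_left ((Submodule.span_singleton_le_iff_mem _ _).2 ?_)
    have h := sum_coord_diag (n := m + 1)
    rw [Fin.sum_univ_castSucc] at h
    rw [← sub_eq_iff_eq_add'.2 h.symm, sub_eq_neg_add]
    exact Submodule.add_mem_sup (neg_mem (Submodule.sum_mem _ fun i _ => coord_mem_cornerForms i i))
      (Submodule.one_le.1 le_rfl)
  have hD : D ^ a ≤ LinearMap.ker S := by
    refine (pow_le_pow_left' (M := Submodule ℂ C(CP (m + 1), ℂ)) hD1 a).trans
      (sup_pow_le fun i j hij f hf => ?_)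
    rw [one_pow (M := Submodule ℂ C(CP (m + 1), ℂ)), mul_one] at hf
    rcases Nat.lt_or_ge i a with hi | hi
    · exact hlow i hi f (cornerForms_pow_le i hf)
    · have : i = a := by omega
      exact hcorner f (this ▸ hf)
  have hP1 : P ≤ weightSpace (centre m) 1 := by
    rw [Submodule.span_le]
    rintro _ ⟨i, rfl⟩
    have := coord_mem_weightSpace (centre m) i.castSucc (Fin.last m)
    rwa [centre_castSucc, centre_last] at this
  have hQ1 : Q ≤ weightSpace (centre m) (-1) := by
    rw [Submodule.span_le]
    rintro _ ⟨i, rfl⟩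
    have := coord_mem_weightSpace (centre m) (Fin.last m) i.castSucc
    rwa [centre_castSucc, centre_last] at this
  have hD0 : D ≤ weightSpace (centre m) 0 := by
    refine sup_le ?_ ((Submodule.span_singleton_le_iff_mem _ _).2 ?_)
    · rw [cornerForms, Submodule.span_le]
      rintro _ ⟨p, rfl⟩
      have := coord_mem_weightSpace (centre m) p.1.castSucc p.2.castSucc
      rwa [centre_castSucc, centre_castSucc] at this
    · have := coord_mem_weightSpace (centre m) (Fin.last m) (Fin.last m)
      rwa [sub_self] at this
  have hmul : ∀ {M N : Submodule ℂ C(CP (m + 1), ℂ)} {d e : ℤ}, M ≤ weightSpace (centre m) d →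
      N ≤ weightSpace (centre m) e → M * N ≤ weightSpace (centre m) (d + e) := by
    intro M N d e hM hN
    exact Submodule.mul_le.2 fun f hf g hg => mul_mem_weightSpace (hM hf) (hN hg)
  have h := sup_sup_pow_le (N := LinearMap.ker S) hPQ hD fun i j k hij f hf => by
    refine hcentre _ ?_ f (hmul (hmul (pow_le_weightSpace hP1 i) (pow_le_weightSpace hQ1 j))
      (pow_le_weightSpace hD0 k) hf)
    have : (i : ℤ) ≠ j := by exact_mod_cast hij
    omega
  exact h (pow_le_pow_left' (M := Submodule ℂ C(CP (m + 1), ℂ)) hall a hf)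

variable [NeZero m]

theorem act_scalar {τ : Circle} {k : ℕ} {F : C(CP m, ℂ)} (hF : F ∈ linForms m ^ k) :
    act (oneParam (fun _ => 1) τ) F = F := by
  have h1 : linForms m ≤ weightSpace (fun _ => 1) 0 := by
    rw [linForms, Submodule.span_le]
    rintro _ ⟨p, rfl⟩
    exact coord_mem_weightSpace (fun _ => 1) p.1 p.2
  have h := pow_le_weightSpace h1 k hF τ
  simpa using h

end

/-! ### A nonvanishing projection to the harmonic space -/

section

variable {n : ℕ}

/-- For `n ≥ 3` some unitary matrix has no zero entries: the reflection
`1 - (2/n) J`, where `J` is the matrix with all entries equal to `1`. -/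
theorem exists_unitary_entries_ne_zero (hn : 3 ≤ n) : ∃ g : U n, ∀ i j, g.1 i j ≠ 0 := by
  have hn0 : (n : ℂ) ≠ 0 := by exact_mod_cast (by omega : n ≠ 0)
  refine ⟨⟨Matrix.of fun i j => (if i = j then 1 else 0) - 2 / (n : ℂ), ?_⟩, fun i j => ?_⟩
  · rw [Matrix.mem_unitaryGroup_iff']
    ext i j
    rw [Matrix.mul_apply, Matrix.one_apply]
    have : ∀ k : Fin n,
        (star (Matrix.of fun i j : Fin n => (if i = j then 1 else 0) - 2 / (n : ℂ)) :
        Matrix (Fin n) (Fin n) ℂ) i k * (Matrix.of fun i j : Fin n => (if i = j then 1 else 0)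
          - 2 / (n : ℂ)) k j = (if k = i then (if i = j then 1 else 0) - 2 / (n : ℂ) else 0)
          - (2 / (n : ℂ)) * (if k = j then 1 else 0) + (2 / (n : ℂ)) ^ 2 := by
      intro k
      by_cases hki : k = i
      · subst hki
        simp [Matrix.star_apply]
        split_ifs <;> ring
      · simp [Matrix.star_apply, hki]
        split_ifs <;> ring
    rw [Finset.sum_congr rfl fun k _ => this k, Finset.sum_add_distrib, Finset.sum_sub_distrib,
      ← Finset.mul_sum, Finset.sum_ite_eq' Finset.univ i, Finset.sum_ite_eq' Finset.univ j]
    simp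
    field_simp
    ring
  · change (if i = j then 1 else 0) - 2 / (n : ℂ) ≠ 0
    split_ifs
    · intro h
      have h1 : (n : ℂ) = 2 := by
        field_simp at h
        linear_combination h
      have : n = 2 := by exact_mod_cast h1
      omega
    · simpa using hn0

/-- `f` equals `c xᵈ` up to functions of weight less than `2d`. -/
def HasLeadingCoeff (w : Fin n → ℤ) (x : C(CP n, ℂ)) (d : ℕ) (f : C(CP n, ℂ)) (c : ℂ) : Prop :=
  f - c • x ^ d ∈ weightLE w (d * 2 - 1)

theorem HasLeadingCoeff.mul {w : Fin n → ℤ} {x f g : C(CP n, ℂ)} {d e : ℕ} {a b : ℂ}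
    (hx : x ∈ weightSpace w 2) (hf : HasLeadingCoeff w x d f a) (hg : HasLeadingCoeff w x e g b) :
    HasLeadingCoeff w x (d + e) (f * g) (a * b) := by
  have hpow : ∀ (k : ℕ) (c : ℂ), c • x ^ k ∈ weightLE w (k * 2) := fun k c =>
    Submodule.smul_mem _ _ (mem_weightLE le_rfl (pow_mem_weightSpace hx k))
  have hg' : g ∈ weightLE w (e * 2) := by
    rw [← sub_add_cancel g (b • x ^ e)]
    exact add_mem (weightLE_mono (by omega) hg) (hpow e b)
  have h1 := mul_mem_weightLE hf hg'
  have h2 := mul_mem_weightLE (hpow d a) hg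
  have key : f * g - (a * b) • x ^ (d + e)
      = (f - a • x ^ d) * g + a • x ^ d * (g - b • x ^ e) := by
    rw [sub_mul, mul_sub, smul_mul_smul_comm, pow_add]
    abel
  rw [HasLeadingCoeff, key]
  refine add_mem (weightLE_mono ?_ h1) (weightLE_mono ?_ h2) <;> push_cast <;> linarith

theorem HasLeadingCoeff.pow {w : Fin n → ℤ} {x f : C(CP n, ℂ)} {a : ℂ}
    (hx : x ∈ weightSpace w 2) (hf : HasLeadingCoeff w x 1 f a) (k : ℕ) :
    HasLeadingCoeff w x k (f ^ k) (a ^ k) := by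
  induction k with
  | zero => simp [HasLeadingCoeff]
  | succ k ih => simpa only [pow_succ] using ih.mul hx hf

variable [NeZero n]

theorem hasLeadingCoeff_act_coord (g : U n) {i j : Fin n} (k l : Fin n) :
    HasLeadingCoeff (root i j) (coord i j) 1 (act g (coord k l)) (conj (g.1 i k) * g.1 j l) := by
  rw [HasLeadingCoeff, act_coord, ← Fintype.sum_prod_type'
    (fun a b => (conj (g.1 a k) * g.1 b l) • (coord a b : C(CP n, ℂ))),
    ← Finset.add_sum_erase _ _ (Finset.mem_univ (i, j)), pow_one, add_sub_cancel_left]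
  refine Submodule.sum_mem _ fun p hp => Submodule.smul_mem _ _ ?_
  exact mem_weightLE (root_sub_root_le_one (Finset.mem_erase.1 hp).1)
    (coord_mem_weightSpace (root i j) p.1 p.2)

/-- The function `(zᵢ z̄ⱼ)ᵇ |zₗ|²ᶜ` has a nonzero component in the harmonic space of degree `b + c`:
a suitable translate of it has a nonzero inner product with `(zᵢ z̄ⱼ)ᵇ⁺ᶜ`. -/
theorem IsModel.apply_ne_zero (hn : 3 ≤ n) {V : Type*} [NormedAddCommGroup V]
    [InnerProductSpace ℂ V] {π : ContRepresentation ℂ (U n) V} {b c : ℕ}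
    {L : C(CP n, ℂ) →ₗ[ℂ] V} (hL : ∀ g f, L (act g f) = π g (L f))
    (hlow : ∀ i < b + c, ∀ f ∈ linForms n ^ i, L f = 0) (h : IsModel π (b + c) L)
    {i j : Fin n} (hij : i ≠ j) (l : Fin n) : L (coord i j ^ b * coord l l ^ c) ≠ 0 := by
  intro h0
  obtain ⟨g, hg⟩ := exists_unitary_entries_ne_zero hn
  set f : C(CP n, ℂ) := coord i j ^ b * coord l l ^ c with hf
  have hmem : f ∈ linForms n ^ (b + c) := by
    rw [pow_add (M := Submodule ℂ C(CP n, ℂ))]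
    exact Submodule.mul_mem_mul (Submodule.pow_mem_pow _ (coord_mem i j) b)
      (Submodule.pow_mem_pow _ (coord_mem l l) c)
  obtain ⟨p, hp, hfp⟩ := exists_harmonic_add (act_mem_pow g hmem)
  have hp0 : p = 0 := by
    refine h.eq_zero p hp ?_
    have h1 : L (act g f - p) = 0 := by
      rcases hfp with h1 | ⟨r, hr, h1⟩
      · rw [h1, map_zero]
      · exact hlow r hr _ h1
    rw [map_sub, hL, h0, map_zero, zero_sub, neg_eq_zero] at h1
    exact h1
  rw [hp0, sub_zero] at hfp
  have horth := inner_eq_zero_of_mem_harmonic (coord_pow_mem_harmonic hij (b + c)) hfp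
  have hx := coord_mem_weightSpace_root hij
  have hlead : HasLeadingCoeff (root i j) (coord i j) (b + c) (act g f)
      ((conj (g.1 i i) * g.1 j j) ^ b * (conj (g.1 i l) * g.1 j l) ^ c) := by
    rw [hf, map_mul, map_pow, map_pow]
    exact ((hasLeadingCoeff_act_coord g i j).pow hx b).mul hx
      ((hasLeadingCoeff_act_coord g l l).pow hx c)
  have hlead0 := inner_eq_zero_of_mem_weightLE (by omega) (pow_mem_weightSpace hx (b + c)) hlead
  rw [map_sub, inner_sub_right, horth, zero_sub, neg_eq_zero, map_smul, inner_smul_right,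
    mul_eq_zero] at hlead0
  rcases hlead0 with h1 | h1
  · refine mul_ne_zero (pow_ne_zero _ (mul_ne_zero ?_ (hg j j)))
      (pow_ne_zero _ (mul_ne_zero ?_ (hg j l))) h1
    · simpa using hg i i
    · simpa using hg i l
  · exact coord_pow_ne_zero hij _ (eq_zero_of_inner_self h1)

end

/-! ### Branching from `U(m+1)` to `U(m)` -/

section

variable {m : ℕ} [NeZero m] {V W : Type*} [NormedAddCommGroup V] [InnerProductSpace ℂ V]
  [NormedAddCommGroup W] [InnerProductSpace ℂ W] {P : ContRepresentation ℂ (U (m + 1)) V}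
  {p : ContRepresentation ℂ (U m) W} {a b : ℕ} {L : C(CP (m + 1), ℂ) →ₗ[ℂ] V}
  {L' : C(CP m, ℂ) →ₗ[ℂ] W}

/-- An intertwiner is determined by its values on the functions of degree `a` in the first `m`
coordinates. -/
theorem intertwiner_eq_zero (hL : ∀ g f, L (act g f) = P g (L f))
    (hlow : ∀ i < a, ∀ f ∈ linForms (m + 1) ^ i, L f = 0) (h : IsModel P a L)
    (h' : IsModel p b L') (T : P.restrict (embed m) →ⁱL p)
    (hT : ∀ f ∈ cornerForms m ^ a, T (L f) = 0) : T = 0 := by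
  have hS : ∀ f ∈ linForms (m + 1) ^ a, (T.toLinearMap ∘ₗ L) f = 0 := by
    intro f hf
    refine eq_zero_of_corner (fun i hi f hf => ?_) (fun d hd f hf => ?_) hT hf
    · change T (L f) = 0
      rw [hlow i hi f hf, map_zero]
    · change T (L f) = 0
      obtain ⟨τ, hτ⟩ := exists_circle_zpow_ne_one hd
      obtain ⟨F, hF, hFT⟩ := h'.surj (T (L f))
      have h1 : T (L (act (oneParam (centre m) τ) f)) = T (L f) := by
        rw [← embed_oneParam, hL]
        refine (T.isIntertwining (oneParam (fun _ => 1) τ) (L f)).trans ?_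
        rw [← hFT, ← h'.map_act _ F hF, act_scalar (harmonic_le_pow b hF)]
      rw [hf τ, map_smul, map_smul] at h1
      have h2 : ((τ : ℂ) ^ d - 1) • T (L f) = 0 := by rw [sub_smul, one_smul, h1, sub_self]
      exact (smul_eq_zero.1 h2).resolve_left (sub_ne_zero.2 hτ)
  refine ContIntertwiningMap.ext (ContinuousLinearMap.ext fun v => ?_)
  obtain ⟨f, hf, rfl⟩ := h.surj v
  exact hS f (harmonic_le_pow a hf)

/-- Given the model of `p` of degree `b`, a nonzero intertwiner is nonzero on the harmonic
functions of degree `b` on the hyperplane, extended to functions of degree `a`; in particular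
`b ≤ a`. -/
theorem exists_harmonic_ne_zero {j : Fin m} (hj : j ≠ 0) (hjm : (j : ℕ) + 1 = m)
    (hL : ∀ g f, L (act g f) = P g (L f))
    (hlow : ∀ i < a, ∀ f ∈ linForms (m + 1) ^ i, L f = 0) (h : IsModel P a L)
    (h' : IsModel p b L') (hp : IsIrreducibleRep p) (hw : IsHighestWeight p (sphericalWeight m b))
    {E : C(CP m, ℂ) →ₗ[ℂ] C(CP (m + 1), ℂ)}
    (hE : ∀ F ∈ linForms m ^ a, E F ∈ cornerForms m ^ a ∧ res (E F) = F)
    {T : P.restrict (embed m) →ⁱL p} (hT : T ≠ 0) :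
    b ≤ a ∧ ∃ F ∈ harmonic m b, T (L (E F)) ≠ 0 := by
  let S : C(CP m, ℂ) →ₗ[ℂ] W := T.toLinearMap ∘ₗ L ∘ₗ E
  obtain ⟨F, hF, hF0⟩ : ∃ F ∈ linForms m ^ a, S F ≠ 0 := by
    by_contra! hc
    refine hT (intertwiner_eq_zero hL hlow h h' T fun f hf => ?_)
    have hres : res f ∈ linForms m ^ a := by
      rw [← map_res_cornerForms_pow]
      exact Submodule.mem_map_of_mem hf
    have hEf : E (res f) = f := by
      rw [← sub_eq_zero]
      refine eq_zero_of_res_eq_zero (sub_mem (hE _ hres).1 hf) ?_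
      rw [map_sub, (hE _ hres).2, sub_self]
    rw [← hEf]
    exact hc _ hres
  obtain ⟨k, hk, G, hG, hG0⟩ : ∃ k ≤ a, ∃ G ∈ harmonic m k, S G ≠ 0 := by
    by_contra! hc
    have hle : linForms m ^ a ≤ LinearMap.ker S :=
      (pow_le_iSup_harmonic a).trans (iSup₂_le fun k hk G hG => hc k hk G hG)
    exact hF0 (hle hF)
  have hmodel : IsModel p k S := by
    refine isModel_of_ne_zero hj hp (fun A G hG => ?_) ⟨G, hG, hG0⟩
    change T (L (E (act A G))) = p A (T (L (E G)))
    rw [extension_act hE A (linForms_pow_mono hk (harmonic_le_pow k hG)), hL]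
    exact T.isIntertwining A _
  have hkb : b = k := by exact_mod_cast hmodel.eq_of_isHighestWeight hj hjm hw
  subst hkb
  exact ⟨hk, G, hG, hG0⟩

theorem finrank_intertwiners_eq_one {j : Fin m} (hj : j ≠ 0) (hjm : (j : ℕ) + 1 = m)
    (hL : ∀ g f, L (act g f) = P g (L f))
    (hlow : ∀ i < a, ∀ f ∈ linForms (m + 1) ^ i, L f = 0) (h : IsModel P a L)
    (h' : IsModel p b L') (hp : IsIrreducibleRep p) (hw : IsHighestWeight p (sphericalWeight m b))
    {T₀ : P.restrict (embed m) →ⁱL p} (hT₀ : T₀ ≠ 0) :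
    Module.finrank ℂ (P.restrict (embed m) →ⁱL p) = 1 := by
  obtain ⟨E, hE⟩ := exists_extension m a
  have hne := fun {T : P.restrict (embed m) →ⁱL p} (hT : T ≠ 0) =>
    exists_harmonic_ne_zero hj hjm hL hlow h h' hp hw hE hT
  have hba := (hne hT₀).1
  have hact : ∀ (T : P.restrict (embed m) →ⁱL p) (A : U m), ∀ F ∈ harmonic m b,
      (T.toLinearMap ∘ₗ L ∘ₗ E) (act A F) = p A ((T.toLinearMap ∘ₗ L ∘ₗ E) F) := by
    intro T A F hF
    change T (L (E (act A F))) = p A (T (L (E F)))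
    rw [extension_act hE A (linForms_pow_mono hba (harmonic_le_pow b hF)), hL]
    exact T.isIntertwining A _
  have hmodel := isModel_of_ne_zero hj hp (hact T₀) (hne hT₀).2
  refine finrank_eq_one_iff_of_nonzero' T₀ hT₀ |>.2 fun T => ?_
  obtain ⟨c, hc⟩ := hmodel.exists_smul hj (hact T)
  refine ⟨c, ?_⟩
  by_contra hTc
  obtain ⟨-, F, hF, hF0⟩ := hne (T := T - c • T₀) fun h0 => hTc (sub_eq_zero.1 h0).symm
  exact hF0 (sub_eq_zero.2 (hc F hF))

/-- For `b ≤ a`, multiplication by `|zₘ₊₁|^(2(a-b))` followed by projection to the harmonic space of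
degree `a` is a nonzero intertwiner from the harmonic functions of degree `b` on the hyperplane; its
adjoint is an intertwiner in the opposite direction. -/
theorem exists_intertwiner_ne_zero [CompleteSpace V] [CompleteSpace W] {j : Fin m} (hj : j ≠ 0)
    (hP : IsUnitaryRep P) (hp : IsUnitaryRep p) (hL : ∀ g f, L (act g f) = P g (L f))
    (hlow : ∀ i < a, ∀ f ∈ linForms (m + 1) ^ i, L f = 0) (h : IsModel P a L)
    (h' : IsModel p b L') (hba : b ≤ a) : ∃ T : P.restrict (embed m) →ⁱL p, T ≠ 0 := by
  obtain ⟨c, rfl⟩ := Nat.exists_eq_add_of_le hba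
  obtain ⟨E, hE⟩ := exists_extension m b
  let y : C(CP (m + 1), ℂ) := coord (Fin.last m) (Fin.last m) ^ c
  let R : C(CP m, ℂ) →ₗ[ℂ] V := L ∘ₗ LinearMap.mulRight ℂ y ∘ₗ E
  have hR : ∀ F, R F = L (E F * y) := fun F => rfl
  have hRact : ∀ A, ∀ F ∈ harmonic m b, R (act A F) = P (embed m A) (R F) := by
    intro A F hF
    have hy : act (embed m A) y = y := by rw [map_pow, act_embed_coord_last]
    rw [hR, hR, ← hL, map_mul (act (embed m A)), hy, extension_act hE A (harmonic_le_pow b hF)]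
  have hRne : R (coord 0 j ^ b) ≠ 0 := by
    have hmem : (coord 0 j : C(CP m, ℂ)) ^ b ∈ linForms m ^ b :=
      Submodule.pow_mem_pow _ (coord_mem 0 j) b
    have hEx : E (coord 0 j ^ b) = coord (Fin.castSucc 0) j.castSucc ^ b := by
      rw [← sub_eq_zero]
      refine eq_zero_of_res_eq_zero (sub_mem (hE _ hmem).1
        (Submodule.pow_mem_pow _ (coord_mem_cornerForms 0 j) b)) ?_
      rw [map_sub, (hE _ hmem).2, map_pow, res_coord, sub_self]
    have hj0 : (j : ℕ) ≠ 0 := fun h => hj (Fin.ext (by simpa using h))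
    rw [hR, hEx]
    exact IsModel.apply_ne_zero (by omega) hL hlow h
      (fun hc => hj (Fin.castSucc_injective _ hc).symm) _
  have := h.finiteDimensional
  have := h'.finiteDimensional
  let e : harmonic m b ≃ₗ[ℂ] W := LinearEquiv.ofBijective (L'.domRestrict (harmonic m b))
    ⟨(injective_iff_map_eq_zero _).2 fun f hf => Subtype.ext (h'.eq_zero f f.2 hf), fun v => by
      obtain ⟨f, hf, rfl⟩ := h'.surj v
      exact ⟨⟨f, hf⟩, rfl⟩⟩
  let Q : W →L[ℂ] V := LinearMap.toContinuousLinearMap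
    (R.domRestrict (harmonic m b) ∘ₗ e.symm.toLinearMap)
  have hQ : ∀ F ∈ harmonic m b, Q (L' F) = R F := by
    intro F hF
    exact congrArg (R.domRestrict (harmonic m b)) (e.symm_apply_apply ⟨F, hF⟩)
  have hQact : ∀ A w, Q (p A w) = P (embed m A) (Q w) := by
    intro A w
    obtain ⟨F, hF, rfl⟩ := h'.surj w
    rw [← h'.map_act A F hF, hQ _ (act_mem_harmonic A hF), hRact A F hF, hQ F hF]
  refine ⟨⟨Q.adjoint, fun A => ?_⟩, fun h0 => hRne ?_⟩
  · ext v
    refine ext_inner_right ℂ fun w => ?_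
    change inner ℂ (Q.adjoint (P (embed m A) v)) w = inner ℂ (p A (Q.adjoint v)) w
    rw [hp.inner_map_left, ContinuousLinearMap.adjoint_inner_left,
      ContinuousLinearMap.adjoint_inner_left, hQact, hP.inner_map_left, map_inv (embed m)]
  · have hadj : Q.adjoint = 0 := congrArg ContIntertwiningMap.toContinuousLinearMap h0
    have hQ0 : Q = 0 := by rw [← ContinuousLinearMap.adjoint_adjoint Q, hadj, map_zero]
    rw [← hQ _ (coord_pow_mem_harmonic hj.symm b), hQ0]
    rfl

end

end CPBranching

end

theorem mainTheorem9 (m : ℕ) (hm : 2 ≤ m) (a b : ℤ)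
    {V W : Type*}
    [NormedAddCommGroup V] [InnerProductSpace ℂ V] [CompleteSpace V]
    [NormedAddCommGroup W] [InnerProductSpace ℂ W] [CompleteSpace W]
    (P : ContRepresentation ℂ (CPBranching.U (m + 1)) V)
    (p : ContRepresentation ℂ (CPBranching.U m) W)
    (hP : CPBranching.IsInDiscreteSpectrum P)
    (hPa : CPBranching.IsHighestWeight P (CPBranching.sphericalWeight (m + 1) a))
    (hp : CPBranching.IsInDiscreteSpectrum p)
    (hpb : CPBranching.IsHighestWeight p (CPBranching.sphericalWeight m b)) :
    ((∃ T : P.restrict (CPBranching.embed m) →ⁱL p, T ≠ 0) ↔ (a ≥ b ∧ b ≥ 0)) ∧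
      (a ≥ b ∧ b ≥ 0 →
        Module.finrank ℂ (P.restrict (CPBranching.embed m) →ⁱL p) = 1) := by
  have : NeZero m := ⟨by omega⟩
  have hj : (⟨m - 1, by omega⟩ : Fin m) ≠ 0 := by
    intro h
    have := congrArg Fin.val h
    simp at this
    omega
  have hjm : ((⟨m - 1, by omega⟩ : Fin m) : ℕ) + 1 = m := by
    change m - 1 + 1 = m
    omega
  have hl : Fin.last m ≠ 0 := by
    intro h
    have := congrArg Fin.val h
    simp at this
    omega
  obtain ⟨k, L, hL, hlow, hmodel⟩ := hP.exists_isModel hl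
  obtain ⟨k', L', -, -, hmodel'⟩ := hp.exists_isModel hj
  obtain rfl := hmodel.eq_of_isHighestWeight hl (by simp) hPa
  obtain rfl := hmodel'.eq_of_isHighestWeight hj hjm hpb
  have hex : k' ≤ k → ∃ T : P.restrict (CPBranching.embed m) →ⁱL p, T ≠ 0 := fun hk =>
    CPBranching.exists_intertwiner_ne_zero hj hP.unitary hp.unitary hL hlow hmodel hmodel' hk
  refine ⟨⟨?_, fun h => hex (by exact_mod_cast h.1)⟩, fun h => ?_⟩
  · rintro ⟨T, hT⟩
    obtain ⟨E, hE⟩ := CPBranching.exists_extension m k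
    have := (CPBranching.exists_harmonic_ne_zero hj hjm hL hlow hmodel hmodel' hp.irreducible hpb
      hE hT).1
    exact ⟨by exact_mod_cast this, by positivity⟩
  · obtain ⟨T, hT⟩ := hex (by exact_mod_cast h.1)
    exact CPBranching.finrank_intertwiners_eq_one hj hjm hL hlow hmodel hmodel'
      hp.irreducible hpb hT
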